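/- Let $k\ge 2$ be a fixed integer. For real $x\ge 1$, let $n$ be a random integer chosen uniformly from the integers in $[1,x]$ and, given $n$, let $(d_1,\dots,d_k)$ be a random $k$-tuple chosen uniformly from the set of all ordered factorizations $\{(m_1,\dots,m_k)\in\mathbb{N}^k : m_1\cdots m_k=n\}$, where $\mathbb{N}=\{1,2,\dots\}$. Then, as $x\to\infty$, we have the convergence in distribution (weak convergence of laws on $\mathbb{R}^k$) \[ \left(\frac{\log d_1}{\log n},\dots,\frac{\log d_k}{\log n}\right)\xrightarrow{\ d\ }\mathrm{Dir}\left(\frac1k,\dots,\frac1k\right), \] where for $n=1$ (an event whose probability tends to $0$) the vector on the left is taken to be $0$. Here, for $\alpha_1,\dots,\alpha_k>0$, $\mathrm{Dir}(\alpha_1,\dots,\alpha_k)$ is the probability measure on the simplex $\{(t_1,\dots,t_k)\in[0,1]^k : t_1+\cdots+t_k=1\}$ that has, with respect to $dt_1\cdots dt_{k-1}$, the density \[ \frac{\Gamma(\alpha_1+\cdots+\alpha_k)}{\Gamma(\alpha_1)\cdots\Gamma(\alpha_k)}\prod_{i=1}^k t_i^{\alpha_i-1}. \] -/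

import Mathlib

open MeasureTheory

noncomputable section

/-! ### The Dirichlet distribution -/

/-- The point `(t₁, …, t_{k-1}, 1 - t₁ - ⋯ - t_{k-1})` of `ℝᵏ`. -/
def simplexPoint (k : ℕ) (t : Fin (k - 1) → ℝ) : Fin k → ℝ :=
  fun i => if h : (i : ℕ) < k - 1 then t ⟨i, h⟩ else 1 - ∑ j, t j

/-- The measure `dt₁ ⋯ dt_{k-1}` on the probability simplex
`{t ∈ ℝᵏ : tᵢ ≥ 0, t₁ + ⋯ + tₖ = 1}`, seen as a measure on `ℝᵏ`. -/
def simplexMeasure (k : ℕ) : Measure (Fin k → ℝ) :=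
  ((volume : Measure (Fin (k - 1) → ℝ)).map (simplexPoint k)).restrict (stdSimplex ℝ (Fin k))

/-- The density `Γ(∑ αᵢ) / ∏ Γ(αᵢ) * ∏ tᵢ ^ (αᵢ - 1)`. -/
def dirichletDensity {k : ℕ} (α : Fin k → ℝ) (t : Fin k → ℝ) : ℝ :=
  Real.Gamma (∑ i, α i) / (∏ i, Real.Gamma (α i)) * ∏ i, t i ^ (α i - 1)

/-- The Dirichlet distribution `Dir(α₁, …, αₖ)`, as a measure on `ℝᵏ` carried by the
probability simplex. -/
def dirichletMeasure {k : ℕ} (α : Fin k → ℝ) : Measure (Fin k → ℝ) :=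
  (simplexMeasure k).withDensity fun t => ENNReal.ofReal (dirichletDensity α t)

/-! ### The random factorization -/

theorem finMulAntidiag_nonempty {k n : ℕ} (hk : 0 < k) (hn : n ≠ 0) :
    (Nat.finMulAntidiag k n).Nonempty :=
  ⟨Pi.mulSingle ⟨0, hk⟩ n, Nat.mem_finMulAntidiag.mpr ⟨by simp, hn⟩⟩

theorem Icc_one_floor_nonempty {x : ℝ} (hx : 1 ≤ x) : (Finset.Icc 1 ⌊x⌋₊).Nonempty :=
  Finset.nonempty_Icc.mpr (Nat.one_le_floor_iff x |>.mpr hx)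

/-- A uniformly random integer of `[1, x]`. -/
def uniformInteger (x : ℝ) (hx : 1 ≤ x) : PMF ℕ :=
  PMF.uniformOfFinset (Finset.Icc 1 ⌊x⌋₊) (Icc_one_floor_nonempty hx)

/-- A uniformly random ordered factorization `n = d₁ ⋯ dₖ` of a given `n ≥ 1`. -/
def uniformFactorization (k n : ℕ) (hk : 0 < k) (hn : n ≠ 0) : PMF (Fin k → ℕ) :=
  PMF.uniformOfFinset (Nat.finMulAntidiag k n) (finMulAntidiag_nonempty hk hn)

theorem ne_zero_of_mem_support_uniformInteger {x : ℝ} {hx : 1 ≤ x} {n : ℕ}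
    (hn : n ∈ (uniformInteger x hx).support) : n ≠ 0 := by
  rw [uniformInteger, PMF.mem_support_uniformOfFinset_iff, Finset.mem_Icc] at hn
  omega

/-- The joint law of `(n, (d₁, …, dₖ))`: first `n` is chosen uniformly from the integers of
`[1, x]`, then, given `n`, the tuple is chosen uniformly from the ordered factorizations of `n`. -/
def integerAndFactorization (k : ℕ) (hk : 0 < k) (x : ℝ) (hx : 1 ≤ x) :
    PMF (ℕ × (Fin k → ℕ)) :=
  (uniformInteger x hx).bindOnSupport fun n hn =>
    (uniformFactorization k n hk (ne_zero_of_mem_support_uniformInteger hn)).map (Prod.mk n)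

/-- The vector `(log d₁ / log n, …, log dₖ / log n)`. -/
def logVector {k : ℕ} (p : ℕ × (Fin k → ℕ)) : Fin k → ℝ :=
  fun i => Real.log (p.2 i) / Real.log p.1

end

noncomputable section

/-! ### Primes -/

/-! The method of moments applies: all laws live on the cube `[0, 1] ^ k`, where polynomials are
uniformly dense, so it suffices that `E ∏ (log dᵢ / log n) ^ aᵢ` tends to the corresponding
Dirichlet moment for every exponent vector `a`.

Let `M_a(n)` be the mean of `∏ (log dᵢ) ^ aᵢ` over the ordered factorizations of `n`, and `m = ∑
aᵢ`. The core is `∑_{n ≤ x} M_a(n) = D_a x (log x) ^ m + O(x (1 + log x) ^ (m - 1))` for `m ≥ 1`,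
with error `O(1)` for `m = 0` (`hasLogMean_logMoment`), by induction on `m`. Take `i` with `aᵢ = s +
1` and write one factor as `log dᵢ = ∑ v_p(dᵢ) log p`. If `p` divides `n` exactly once, it falls on
each of the `k` factors with probability `1 / k`, independently of the induced factorization of `n /
p` (`factorizationMean_prime_mul`). Expanding `(log p + log dᵢ) ^ s` expresses `∑ M_a` through sums
of lower moments up to `x / p`, weighted by powers of `log p`; repeated primes cost only `O(x (log
x) ^ (m - 1))`. Mertens' first theorem and partial summation turn the sums over `p` into Beta
integrals. The constants `D_a` obey the same recurrence as the Dirichlet moments, by a telescoping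
Gamma identity (`dirichletMoment_update_succ`).

On the other side, the Dirichlet moments come from Dirichlet's integral
(`lintegral_prod_powDensity`), an iterated convolution of power functions. Finally `log N` may be
replaced by `log n` in the normalization, because `log n / log N` is close to `1` on average
(`abs_sum_div_log_pow_sub_le`). -/

theorem log_factorial_eq_sum_primesLE (N : ℕ) :
    Real.log (N.factorial : ℝ) =
      ∑ p ∈ Nat.primesLE N, (N.factorial.factorization p : ℝ) * Real.log p := by
  rw [Real.log_nat_eq_sum_factorization, Finsupp.sum]
  refine Finset.sum_subset ?_ ?_
  · intro p hp
    rw [Nat.support_factorization, Nat.mem_primeFactors] at hp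
    exact Nat.mem_primesLE.mpr ⟨(hp.1.dvd_factorial).mp hp.2.1, hp.1⟩
  · intro p _ hp
    rw [Finsupp.notMem_support_iff.mp hp]; simp

theorem div_le_factorization_factorial {p : ℕ} (hp : p.Prime) (N : ℕ) :
    N / p ≤ N.factorial.factorization p := by
  -- Only the first term of Legendre's formula is kept; `+ 2` rather than `+ 1` ensures that `Ico 1
  -- b` contains `1` even when `Nat.log p N = 0`.
  rw [Nat.factorization_factorial hp (b := Nat.log p N + 2) (by omega)]
  refine le_trans (by simp) (Finset.single_le_sum (f := fun i => N / p ^ i)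
    (fun _ _ => Nat.zero_le _) (Finset.mem_Ico.mpr ⟨le_refl 1, by omega⟩))

theorem factorization_factorial_le {p : ℕ} (hp : p.Prime) (N : ℕ) :
    (N.factorial.factorization p : ℝ) ≤ N / ((p : ℝ) - 1) := by
  have h := Nat.factorization_factorial_le_div_pred hp N
  have h2 : ((N / (p - 1) : ℕ) : ℝ) ≤ (N : ℝ) / ((p - 1 : ℕ) : ℝ) := Nat.cast_div_le
  rw [Nat.cast_sub hp.one_le, Nat.cast_one] at h2
  exact le_trans (by exact_mod_cast h) h2

theorem sub_one_le_natCast_div (N p : ℕ) : (N : ℝ) / p - 1 ≤ ((N / p : ℕ) : ℝ) := by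
  rw [← Nat.floor_div_eq_div (K := ℝ)]
  linarith [Nat.lt_floor_add_one ((N : ℝ) / p)]

theorem sum_factorization_eq_factorization_factorial (p N : ℕ) :
    ∑ n ∈ Finset.Icc 1 N, n.factorization p = N.factorial.factorization p := by
  induction N with
  | zero => simp
  | succ N ih =>
    rw [Finset.sum_Icc_succ_top (by omega), ih, Nat.factorial_succ,
      Nat.factorization_mul (by omega) N.factorial_ne_zero, Finsupp.add_apply, add_comm]

/-- The primes contribute a convergent sum `∑ log p / (p (p - 1))`. -/
theorem exists_sum_log_div_mul_sub_one_le :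
    ∃ C : ℝ, 0 ≤ C ∧ ∀ N : ℕ,
      ∑ p ∈ Nat.primesLE N, Real.log p / (p * ((p : ℝ) - 1)) ≤ C := by
  -- Since `log p ≤ 2 √p` and `p - 1 ≥ p / 2`, each term is at most `4 p ^ (-3/2)`.
  have hs : Summable fun n : ℕ => 4 * (1 / (n : ℝ) ^ (3 / 2 : ℝ)) :=
    (Real.summable_one_div_nat_rpow.mpr (by norm_num)).mul_left 4
  refine ⟨∑' n : ℕ, 4 * (1 / (n : ℝ) ^ (3 / 2 : ℝ)), tsum_nonneg fun n => by positivity,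
    fun N => ?_⟩
  refine le_trans (Finset.sum_le_sum fun p hp => ?_)
    (hs.sum_le_tsum (Nat.primesLE N) fun n _ => by positivity)
  have h2 : (2 : ℝ) ≤ p := by exact_mod_cast Nat.two_le_of_mem_primesLE hp
  have hp0 : (0 : ℝ) < p := by linarith
  have hlog : Real.log p ≤ 2 * (p : ℝ) ^ (1 / 2 : ℝ) := by
    have := Real.log_le_rpow_div hp0.le (show (0 : ℝ) < 1 / 2 by norm_num)
    linarith
  have hpow : (p : ℝ) ^ (3 / 2 : ℝ) * (p : ℝ) ^ (1 / 2 : ℝ) = p * p := by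
    rw [← Real.rpow_add hp0]; norm_num; ring
  have h1 : (0 : ℝ) < (p : ℝ) ^ (3 / 2 : ℝ) := by positivity
  have h3 : (0 : ℝ) < (p : ℝ) ^ (1 / 2 : ℝ) := by positivity
  rw [mul_one_div, div_le_div_iff₀ (by nlinarith) h1]
  calc Real.log p * (p : ℝ) ^ (3 / 2 : ℝ)
      ≤ 2 * (p : ℝ) ^ (1 / 2 : ℝ) * (p : ℝ) ^ (3 / 2 : ℝ) := by gcongr
    _ = 2 * (p * p) := by rw [← hpow]; ring
    _ ≤ 4 * (p * ((p : ℝ) - 1)) := by nlinarith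

/-- A single term of the exponential series, `N ^ N / N! ≤ exp N`, is all of Stirling's formula that
is needed. -/
theorem natCast_mul_log_sub_le_log_factorial (N : ℕ) :
    (N : ℝ) * Real.log N - N ≤ Real.log (N.factorial : ℝ) := by
  rcases Nat.eq_zero_or_pos N with rfl | hN
  · simp
  have hN' : (0 : ℝ) < N := by exact_mod_cast hN
  have h := Real.pow_div_factorial_le_exp (N : ℝ) hN'.le N
  have hf : (0 : ℝ) < N.factorial := by exact_mod_cast N.factorial_pos
  have := Real.log_le_log (by positivity) h
  rw [Real.log_exp, Real.log_div (by positivity) hf.ne', Real.log_pow] at this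
  linarith

theorem log_factorial_le (N : ℕ) : Real.log (N.factorial : ℝ) ≤ N * Real.log N := by
  rw [← Real.log_pow]
  refine Real.log_le_log (by exact_mod_cast N.factorial_pos) ?_
  exact_mod_cast N.factorial_le_pow

theorem sum_log_primesLE_le (N : ℕ) : ∑ p ∈ Nat.primesLE N, Real.log p ≤ 2 * N := by
  rw [← Chebyshev.theta_eq_sum_primesLE_log]
  refine (Chebyshev.theta_le_log4_mul_x (Nat.cast_nonneg N)).trans ?_
  have : Real.log 4 = 2 * Real.log 2 := by
    rw [show (4 : ℝ) = 2 ^ 2 by norm_num, Real.log_pow]; norm_num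
  have h2 : Real.log 2 ≤ 1 := by linarith [Real.log_two_lt_d9]
  rw [this]
  have : (0 : ℝ) ≤ N := Nat.cast_nonneg N
  nlinarith

/-- **Mertens' first theorem** at integers. -/
theorem exists_abs_sum_log_div_sub_log_le_nat :
    ∃ C : ℝ, 0 ≤ C ∧ ∀ N : ℕ, 1 ≤ N →
      |∑ p ∈ Nat.primesLE N, Real.log p / p - Real.log N| ≤ C := by
  obtain ⟨C, hC, hb⟩ := exists_sum_log_div_mul_sub_one_le
  refine ⟨C + 2, by linarith, fun N hN => ?_⟩
  have hN' : (0 : ℝ) < N := by exact_mod_cast hN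
  have key := log_factorial_eq_sum_primesLE N
  have hlog : ∀ p ∈ Nat.primesLE N, 0 ≤ Real.log p := fun p _ => Real.log_natCast_nonneg p
  rw [abs_le]
  constructor
  -- Legendre's upper bound `N / (p - 1)` splits by `1 / (p - 1) = 1 / p + 1 / (p (p - 1))`, and the
  -- second part has a bounded sum.
  · have hup : Real.log (N.factorial : ℝ) ≤
        N * (∑ p ∈ Nat.primesLE N, Real.log p / p +
          ∑ p ∈ Nat.primesLE N, Real.log p / (p * ((p : ℝ) - 1))) := by
      rw [key, ← Finset.sum_add_distrib, Finset.mul_sum]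
      refine Finset.sum_le_sum fun p hp => ?_
      have h2 : (2 : ℝ) ≤ p := by exact_mod_cast Nat.two_le_of_mem_primesLE hp
      have hp1 : (p : ℝ) - 1 ≠ 0 := by linarith
      have hp0 : (p : ℝ) ≠ 0 := by linarith
      calc (N.factorial.factorization p : ℝ) * Real.log p
          ≤ N / ((p : ℝ) - 1) * Real.log p := mul_le_mul_of_nonneg_right
            (factorization_factorial_le (Nat.prime_of_mem_primesLE hp) N) (hlog p hp)
        _ = _ := by field_simp; ring
    have h := (natCast_mul_log_sub_le_log_factorial N).trans hup
    have h' : Real.log N - 1 ≤ ∑ p ∈ Nat.primesLE N, Real.log p / p +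
          ∑ p ∈ Nat.primesLE N, Real.log p / (p * ((p : ℝ) - 1)) :=
      le_of_mul_le_mul_left (by linarith) hN'
    linarith [hb N]
  -- Rounding `N / p` down loses at most `log p` per prime, in total at most `2 N` by Chebyshev's
  -- bound.
  · have hlow : N * ∑ p ∈ Nat.primesLE N, Real.log p / p - ∑ p ∈ Nat.primesLE N, Real.log p ≤
        Real.log (N.factorial : ℝ) := by
      rw [key, Finset.mul_sum, ← Finset.sum_sub_distrib]
      refine Finset.sum_le_sum fun p hp => ?_
      calc (N : ℝ) * (Real.log p / p) - Real.log p = ((N : ℝ) / p - 1) * Real.log p := by ring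
        _ ≤ (N.factorial.factorization p : ℝ) * Real.log p := by
            refine mul_le_mul_of_nonneg_right ((sub_one_le_natCast_div N p).trans ?_) (hlog p hp)
            exact_mod_cast div_le_factorization_factorial (Nat.prime_of_mem_primesLE hp) N
    have h := hlow.trans (log_factorial_le N)
    have h' : ∑ p ∈ Nat.primesLE N, Real.log p / p ≤ Real.log N + 2 := by
      refine le_of_mul_le_mul_left ?_ hN'
      linarith [sum_log_primesLE_le N]
    linarith

/-- **Mertens' first theorem**. -/
theorem exists_abs_sum_log_div_sub_log_le :
    ∃ C : ℝ, 0 ≤ C ∧ ∀ x : ℝ, 1 ≤ x →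
      |∑ p ∈ Nat.primesLE ⌊x⌋₊, Real.log p / p - Real.log x| ≤ C := by
  obtain ⟨C, hC, hb⟩ := exists_abs_sum_log_div_sub_log_le_nat
  refine ⟨C + 1, by linarith, fun x hx => ?_⟩
  have h1 : 1 ≤ ⌊x⌋₊ := (Nat.one_le_floor_iff x).mpr hx
  have h1' : (1 : ℝ) ≤ ⌊x⌋₊ := by exact_mod_cast h1
  have hle : (⌊x⌋₊ : ℝ) ≤ x := Nat.floor_le (by linarith)
  have hlt := Nat.lt_floor_add_one x
  have ha : Real.log ⌊x⌋₊ ≤ Real.log x := Real.log_le_log (by linarith) hle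
  have hb' : Real.log x - Real.log ⌊x⌋₊ ≤ 1 := by
    rw [← Real.log_div (by linarith) (by linarith)]
    refine (Real.log_le_sub_one_of_pos (by positivity)).trans ?_
    rw [sub_le_iff_le_add, div_le_iff₀ (by linarith)]
    linarith
  have := abs_le.mp (hb _ h1)
  rw [abs_le]
  constructor <;> linarith [this.1, this.2]

/-- Repeated prime factors contribute `O(N)` to `∑_{n ≤ N} log n`. -/
theorem exists_sum_repeated_prime_le :
    ∃ C : ℝ, 0 ≤ C ∧ ∀ N : ℕ,
      ∑ n ∈ Finset.Icc 1 N, ∑ p ∈ n.primeFactors with p ^ 2 ∣ n,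
        (n.factorization p : ℝ) * Real.log p ≤ C * N := by
  obtain ⟨C, hC, hb⟩ := exists_sum_log_div_mul_sub_one_le
  refine ⟨2 * C + 4, by linarith, fun N => ?_⟩
  -- For a repeated prime `v ≤ 2 (v - 1)`. The majorant is nonnegative at every prime, and its sum
  -- over `n` is twice Legendre's formula without its first term, times `log p`.
  have step : ∀ n ∈ Finset.Icc 1 N, ∑ p ∈ n.primeFactors with p ^ 2 ∣ n,
      (n.factorization p : ℝ) * Real.log p ≤
      ∑ p ∈ Nat.primesLE N, 2 * ((n.factorization p : ℝ) - if p ∣ n then 1 else 0) *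
        Real.log p := by
    intro n hn
    rw [Finset.mem_Icc] at hn
    have hnn : ∀ p ∈ Nat.primesLE N,
        0 ≤ 2 * ((n.factorization p : ℝ) - if p ∣ n then 1 else 0) * Real.log p := by
      intro p hp
      refine mul_nonneg (mul_nonneg zero_le_two ?_) (Real.log_natCast_nonneg p)
      split_ifs with h
      · have := (Nat.prime_of_mem_primesLE hp).factorization_pos_of_dvd (by omega) h
        have : (1 : ℝ) ≤ n.factorization p := by exact_mod_cast this
        linarith
      · simp
    refine le_trans (Finset.sum_le_sum fun p hp => ?_)
      (Finset.sum_le_sum_of_subset_of_nonneg (s := n.primeFactors.filter fun p => p ^ 2 ∣ n)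
        ?_ fun p hp _ => hnn p hp)
    · rw [Finset.mem_filter, Nat.mem_primeFactors] at hp
      have h2 : 2 ≤ n.factorization p :=
        (hp.1.1.pow_dvd_iff_le_factorization (by omega)).mp hp.2
      have h2' : (2 : ℝ) ≤ n.factorization p := by exact_mod_cast h2
      rw [if_pos hp.1.2.1]
      refine mul_le_mul_of_nonneg_right ?_ (Real.log_natCast_nonneg p)
      linarith
    · intro p hp
      rw [Finset.mem_filter, Nat.mem_primeFactors] at hp
      exact Nat.mem_primesLE.mpr ⟨(Nat.le_of_dvd (by omega) hp.1.2.1).trans hn.2, hp.1.1⟩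
  refine (Finset.sum_le_sum step).trans ?_
  rw [Finset.sum_comm]
  have inner : ∀ p ∈ Nat.primesLE N,
      ∑ n ∈ Finset.Icc 1 N, 2 * ((n.factorization p : ℝ) - if p ∣ n then 1 else 0) * Real.log p ≤
      2 * N * (Real.log p / (p * ((p : ℝ) - 1))) + 2 * Real.log p := by
    intro p hp
    have hpp := Nat.prime_of_mem_primesLE hp
    have h2 : (2 : ℝ) ≤ p := by exact_mod_cast hpp.two_le
    have hp1 : (p : ℝ) - 1 ≠ 0 := by linarith
    have hp0 : (p : ℝ) ≠ 0 := by linarith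
    rw [← Finset.sum_mul, ← Finset.mul_sum, Finset.sum_sub_distrib, ← Nat.cast_sum,
      sum_factorization_eq_factorization_factorial, Finset.sum_boole]
    have hcard : ((Finset.Icc 1 N).filter fun n => p ∣ n).card = N / p := by
      rw [← Nat.Ioc_filter_dvd_card_eq_div]; rfl
    rw [hcard]
    have hA := factorization_factorial_le hpp N
    have hB := sub_one_le_natCast_div N p
    calc 2 * ((N.factorial.factorization p : ℝ) - ((N / p : ℕ) : ℝ)) * Real.log p
        ≤ 2 * ((N : ℝ) / ((p : ℝ) - 1) - (N / p - 1)) * Real.log p := by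
          refine mul_le_mul_of_nonneg_right ?_ (Real.log_natCast_nonneg p)
          linarith
      _ = _ := by field_simp; ring
  refine (Finset.sum_le_sum inner).trans ?_
  rw [Finset.sum_add_distrib, ← Finset.mul_sum, ← Finset.mul_sum]
  have : (0 : ℝ) ≤ N := Nat.cast_nonneg N
  nlinarith [hb N, sum_log_primesLE_le N]

/-! ### Partial summation over primes -/

/-- Euler's Beta integral at integer exponents. Integration by parts trades a power of `L - u` for a
power of `u`, so the induction on `l` must leave `j` free. -/
theorem integral_pow_mul_sub_pow (L : ℝ) (j l : ℕ) :
    ∫ u in (0 : ℝ)..L, u ^ j * (L - u) ^ l =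
      (j.factorial * l.factorial : ℝ) / (j + l + 1).factorial * L ^ (j + l + 1) := by
  induction l generalizing j with
  | zero =>
    simp only [pow_zero, mul_one, integral_pow, add_zero, Nat.factorial_zero, Nat.cast_one]
    rw [Nat.factorial_succ]
    have : (j.factorial : ℝ) ≠ 0 := by exact_mod_cast j.factorial_ne_zero
    push_cast
    field_simp
    simp
  | succ l ih =>
    have h := intervalIntegral.integral_mul_deriv_eq_deriv_mul
      (a := 0) (b := L) (u := fun u : ℝ => (L - u) ^ (l + 1))
      (v := fun u : ℝ => u ^ (j + 1) / (j + 1))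
      (u' := fun u : ℝ => -((l + 1) * (L - u) ^ l)) (v' := fun u : ℝ => u ^ j)
      (fun u _ => by
        have := ((hasDerivAt_id u).const_sub L).pow (l + 1)
        simp only [id, Nat.add_sub_cancel] at this
        convert! this using 1
        push_cast
        ring)
      (fun u _ => by
        have := (hasDerivAt_pow (j + 1) u).div_const ((j : ℝ) + 1)
        simp only [Nat.add_sub_cancel] at this
        convert! this using 1
        push_cast
        field_simp)
      (by apply Continuous.intervalIntegrable; fun_prop)
      (by apply Continuous.intervalIntegrable; fun_prop)
    have e1 : ∫ u in (0 : ℝ)..L, u ^ j * (L - u) ^ (l + 1) =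
        ∫ u in (0 : ℝ)..L, (L - u) ^ (l + 1) * u ^ j := by
      congr 1; ext u; ring
    have e2 : ∫ u in (0 : ℝ)..L, -((l + 1) * (L - u) ^ l) * (u ^ (j + 1) / (j + 1)) =
        -((l + 1) / (j + 1)) * ∫ u in (0 : ℝ)..L, u ^ (j + 1) * (L - u) ^ l := by
      rw [← intervalIntegral.integral_const_mul]
      congr 1; ext u; ring
    rw [e1, h, e2, ih]
    rw [show j + 1 + l + 1 = j + (l + 1) + 1 by ring, Nat.factorial_succ j, Nat.factorial_succ l]
    have : ((j + (l + 1) + 1).factorial : ℝ) ≠ 0 := by exact_mod_cast Nat.factorial_ne_zero _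
    push_cast
    simp
    field_simp

theorem integral_log_pow_mul_log_pow_div {x : ℝ} (hx : 1 ≤ x) (j l : ℕ) :
    ∫ t in (1 : ℝ)..x, Real.log t ^ j * (Real.log x - Real.log t) ^ l / t =
      (j.factorial * l.factorial : ℝ) / (j + l + 1).factorial * Real.log x ^ (j + l + 1) := by
  rw [← integral_pow_mul_sub_pow]
  have := intervalIntegral.integral_comp_mul_deriv (a := 1) (b := x) (f := Real.log)
    (f' := fun t => t⁻¹) (g := fun u => u ^ j * (Real.log x - u) ^ l)
    (fun t ht => by
      rw [Set.uIcc_of_le hx] at ht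
      exact Real.hasDerivAt_log (by linarith [ht.1]))
    (by
      rw [Set.uIcc_of_le hx]
      exact continuousOn_inv₀.mono fun t ht => by
        have := ht.1
        simp only [Set.mem_compl_iff, Set.mem_singleton_iff]; linarith)
    (by fun_prop)
  rw [Real.log_one] at this
  rw [← this]
  congr 1

/-- Partial summation against the weights `log p / p`. -/
theorem exists_abs_sum_log_div_mul_sub_integral_le (j l : ℕ) :
    ∃ C : ℝ, 0 ≤ C ∧ ∀ x : ℝ, 1 ≤ x →
      |∑ p ∈ Nat.primesLE ⌊x⌋₊, Real.log p ^ (j + 1) / p * Real.log (x / p) ^ l -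
        (j.factorial * l.factorial : ℝ) / (j + l + 1).factorial * Real.log x ^ (j + l + 1)| ≤
      C * (1 + Real.log x) ^ (j + l) := by
  obtain ⟨C, hC, hM⟩ := exists_abs_sum_log_div_sub_log_le
  refine ⟨C + C * (j + l), by positivity, fun x hx => ?_⟩
  set L := Real.log x with hL
  have hL0 : 0 ≤ L := Real.log_nonneg hx
  -- One `log p / p` serves as the Mertens weight; the remaining `j` logarithms go into the smooth
  -- function `f`.
  set c : ℕ → ℝ := fun n => if n.Prime then Real.log n / n else 0 with hc
  set f : ℝ → ℝ := fun t => Real.log t ^ j * (L - Real.log t) ^ l with hf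
  set f' : ℝ → ℝ := fun t => (j * Real.log t ^ (j - 1) * (L - Real.log t) ^ l -
    l * Real.log t ^ j * (L - Real.log t) ^ (l - 1)) / t with hf'
  have hder : ∀ t : ℝ, 1 ≤ t → HasDerivAt f (f' t) t := by
    intro t ht
    have hlog := Real.hasDerivAt_log (show t ≠ 0 by linarith)
    have := (hlog.pow j).mul ((hlog.const_sub L).pow l)
    convert! this using 1
    simp only [hf', Pi.pow_apply]
    ring
  have hcont : ContinuousOn f' (Set.Icc 1 x) := by
    have hlogc : ContinuousOn Real.log (Set.Icc 1 x) := Real.continuousOn_log.mono fun t ht => by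
      have := ht.1
      simp only [Set.mem_compl_iff, Set.mem_singleton_iff]; linarith
    refine ContinuousOn.div (by fun_prop) continuousOn_id fun t ht => ?_
    have := ht.1
    linarith
  have hderiv : Set.EqOn (deriv f) f' (Set.Icc 1 x) := fun t ht => (hder t ht.1).deriv
  set M : ℝ → ℝ := fun t => ∑ n ∈ Finset.Icc 0 ⌊t⌋₊, c n with hMdef
  have hMsum : ∀ t : ℝ, M t = ∑ p ∈ Nat.primesLE ⌊t⌋₊, Real.log p / p := by
    intro t
    rw [Nat.primesLE_eq_filter_Icc_zero, Finset.sum_filter]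
  have hR : ∀ t : ℝ, 1 ≤ t → |M t - Real.log t| ≤ C := by
    intro t ht; rw [hMsum]; exact hM t ht
  have hintegrable : IntegrableOn f' (Set.Icc 1 x) := hcont.integrableOn_Icc
  have habel := sum_mul_eq_sub_integral_mul₀ (f := f) c (by simp [hc]) x
    (fun t ht => (hder t ht.1).differentiableAt)
    (hintegrable.congr_fun (fun t ht => (hderiv ht).symm) measurableSet_Icc)
  have hsum : ∑ p ∈ Nat.primesLE ⌊x⌋₊, Real.log p ^ (j + 1) / p * Real.log (x / p) ^ l =
      ∑ n ∈ Finset.Icc 0 ⌊x⌋₊, f n * c n := by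
    rw [Nat.primesLE_eq_filter_Icc_zero, Finset.sum_filter]
    refine Finset.sum_congr rfl fun p _ => ?_
    simp only [hc, hf]
    split_ifs with hp
    · have : (p : ℝ) ≠ 0 := by exact_mod_cast hp.ne_zero
      rw [Real.log_div (by linarith) this]
      ring
    · ring
  have hMint : IntegrableOn (fun t => f' t * M t) (Set.Icc 1 x) :=
    integrableOn_mul_sum_Icc c (m := 0) zero_le_one hintegrable
  have hI1 : ∫ t in Set.Ioc 1 x, deriv f t * M t = ∫ t in (1 : ℝ)..x, f' t * M t := by
    rw [intervalIntegral.integral_of_le hx]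
    exact setIntegral_congr_fun measurableSet_Ioc fun t ht => by
      simp only [hderiv (Set.Ioc_subset_Icc_self ht)]
  -- Replacing `M` by `log` in Abel's formula and integrating by parts back leaves `∫ f t / t`, the
  -- Beta integral in the variable `log t`. What remains involves only the bounded difference `M -
  -- log`.
  have hparts := intervalIntegral.integral_mul_deriv_eq_deriv_mul
      (a := 1) (b := x) (u := Real.log) (v := f) (u' := fun t => t⁻¹) (v' := f')
      (fun t ht => by
        rw [Set.uIcc_of_le hx] at ht
        exact Real.hasDerivAt_log (by linarith [ht.1]))
      (fun t ht => by
        rw [Set.uIcc_of_le hx] at ht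
        exact hder t ht.1)
      (by
        apply ContinuousOn.intervalIntegrable
        rw [Set.uIcc_of_le hx]
        exact continuousOn_inv₀.mono fun t ht => by
          have := ht.1
          simp only [Set.mem_compl_iff, Set.mem_singleton_iff]; linarith)
      (by
        apply ContinuousOn.intervalIntegrable
        rwa [Set.uIcc_of_le hx])
  have hmain : ∫ t in (1 : ℝ)..x, t⁻¹ * f t =
      (j.factorial * l.factorial : ℝ) / (j + l + 1).factorial * L ^ (j + l + 1) := by
    rw [← integral_log_pow_mul_log_pow_div hx]
    congr 1; ext t; simp only [hf]; ring
  have hlogint : IntervalIntegrable (fun t => f' t * Real.log t) volume 1 x := by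
    apply ContinuousOn.intervalIntegrable
    rw [Set.uIcc_of_le hx]
    refine hcont.mul (Real.continuousOn_log.mono fun t ht => ?_)
    have := ht.1
    simp only [Set.mem_compl_iff, Set.mem_singleton_iff]; linarith
  have hMint' : IntervalIntegrable (fun t => f' t * M t) volume 1 x := by
    rw [intervalIntegrable_iff_integrableOn_Icc_of_le hx]; exact hMint
  have hcomm : ∫ t in (1 : ℝ)..x, Real.log t * f' t = ∫ t in (1 : ℝ)..x, f' t * Real.log t := by
    congr 1; ext t; ring
  have hsplit : ∑ p ∈ Nat.primesLE ⌊x⌋₊, Real.log p ^ (j + 1) / p * Real.log (x / p) ^ l -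
        (j.factorial * l.factorial : ℝ) / (j + l + 1).factorial * L ^ (j + l + 1) =
      f x * (M x - L) - ∫ t in (1 : ℝ)..x, f' t * (M t - Real.log t) := by
    have : ∫ t in (1 : ℝ)..x, f' t * (M t - Real.log t) =
        (∫ t in (1 : ℝ)..x, f' t * M t) - ∫ t in (1 : ℝ)..x, f' t * Real.log t := by
      rw [← intervalIntegral.integral_sub hMint' hlogint]
      congr 1; ext t; ring
    rw [hsum, habel, hI1, this, ← hcomm, hparts, hmain, Real.log_one]
    simp only [← hL]
    ring
  rw [hsplit]
  have hlogle : ∀ t ∈ Set.Icc 1 x, 0 ≤ Real.log t ∧ Real.log t ≤ L := fun t ht =>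
    ⟨Real.log_nonneg ht.1, Real.log_le_log (by linarith [ht.1]) ht.2⟩
  have hfx : |f x| ≤ (1 + L) ^ (j + l) := by
    simp only [hf, ← hL, sub_self]
    rw [abs_of_nonneg (by positivity), pow_add]
    gcongr <;> linarith
  -- Differentiation lowers the degree by one, and `∫ dt / t = L` restores it. For `j + l = 0` the
  -- truncated exponent is harmless because the coefficient vanishes.
  have hf'le : ∀ t ∈ Set.Icc 1 x, |f' t| ≤ (j + l) * (1 + L) ^ (j + l - 1) * t⁻¹ := by
    intro t ht
    obtain ⟨h0, h1⟩ := hlogle t ht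
    have h3 : 0 ≤ L - Real.log t := by linarith
    have ht0 : 0 < t := by linarith [ht.1]
    simp only [hf']
    rw [abs_div, abs_of_pos ht0, div_eq_mul_inv]
    refine mul_le_mul_of_nonneg_right ?_ (by positivity)
    have hA : |(j : ℝ) * Real.log t ^ (j - 1) * (L - Real.log t) ^ l| ≤
        j * (1 + L) ^ (j + l - 1) := by
      rw [abs_of_nonneg (by positivity)]
      rcases Nat.eq_zero_or_pos j with rfl | hj
      · simp
      rw [show j + l - 1 = (j - 1) + l by omega, pow_add, mul_assoc]
      gcongr <;> linarith
    have hB : |(l : ℝ) * Real.log t ^ j * (L - Real.log t) ^ (l - 1)| ≤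
        l * (1 + L) ^ (j + l - 1) := by
      rw [abs_of_nonneg (by positivity)]
      rcases Nat.eq_zero_or_pos l with rfl | hl
      · simp
      rw [show j + l - 1 = j + (l - 1) by omega, pow_add, mul_assoc]
      gcongr <;> linarith
    calc _ ≤ _ := abs_sub _ _
      _ ≤ j * (1 + L) ^ (j + l - 1) + l * (1 + L) ^ (j + l - 1) := add_le_add hA hB
      _ = _ := by ring
  have hIle : |∫ t in (1 : ℝ)..x, f' t * (M t - Real.log t)| ≤
      C * (j + l) * (1 + L) ^ (j + l) := by
    have hbound := intervalIntegral.norm_integral_le_of_norm_le hx (μ := volume)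
      (f := fun t => f' t * (M t - Real.log t))
      (g := fun t => C * ((j + l) * (1 + L) ^ (j + l - 1)) * t⁻¹)
      (by
        refine ae_of_all _ fun t ht => ?_
        rw [Real.norm_eq_abs, abs_mul]
        calc _ ≤ ((j + l) * (1 + L) ^ (j + l - 1) * t⁻¹) * C :=
              mul_le_mul (hf'le t (Set.Ioc_subset_Icc_self ht)) (hR t ht.1.le) (abs_nonneg _)
                (by have := ht.1; positivity)
          _ = _ := by ring)
      (by
        apply ContinuousOn.intervalIntegrable
        rw [Set.uIcc_of_le hx]
        refine continuousOn_const.mul (continuousOn_inv₀.mono fun t ht => ?_)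
        have := ht.1
        simp only [Set.mem_compl_iff, Set.mem_singleton_iff]; linarith)
    rw [intervalIntegral.integral_const_mul, integral_inv_of_pos one_pos (by linarith), div_one,
      Real.norm_eq_abs] at hbound
    refine hbound.trans ?_
    rcases Nat.eq_zero_or_pos (j + l) with h0 | hpos
    · have hj : j = 0 := by omega
      have hl : l = 0 := by omega
      simp [hj, hl]
    · have e : (1 + L) ^ (j + l) = (1 + L) ^ (j + l - 1) * (1 + L) := by
        rw [← pow_succ]; congr 1; omega
      rw [e, ← hL]
      have : 0 ≤ C * ((j + l) * (1 + L) ^ (j + l - 1)) := by positivity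
      nlinarith
  calc _ ≤ |f x * (M x - L)| + |∫ t in (1 : ℝ)..x, f' t * (M t - Real.log t)| := abs_sub _ _
    _ ≤ (1 + L) ^ (j + l) * C + C * (j + l) * (1 + L) ^ (j + l) := by
        refine add_le_add ?_ hIle
        rw [abs_mul]
        exact mul_le_mul hfx (hR x hx) (abs_nonneg _) (by positivity)
    _ = _ := by ring

/-- The admissible error in the mean value of a function of logarithmic degree `l`. -/
def meanError (l : ℕ) (x : ℝ) : ℝ :=
  -- In degree `0` an error `O(x)` would be too weak: summed against `log p ^ (j + 1)` at `x / p` it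
  -- would lose a logarithm.
  if l = 0 then 1 else x * (1 + Real.log x) ^ (l - 1)

/-- Errors from the induction hypothesis stay one logarithm below the main term: degree `0` uses
Chebyshev's `∑ log p = O(x)`, positive degree uses `∑ log p / p = O(1 + log x)`. -/
theorem exists_sum_log_pow_mul_meanError_le (j l : ℕ) :
    ∃ C : ℝ, 0 ≤ C ∧ ∀ x : ℝ, 1 ≤ x →
      ∑ p ∈ Nat.primesLE ⌊x⌋₊, Real.log p ^ (j + 1) * meanError l (x / p) ≤
        C * (x * (1 + Real.log x) ^ (j + l)) := by
  obtain ⟨C, hC, hM⟩ := exists_abs_sum_log_div_sub_log_le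
  refine ⟨C + 2, by linarith, fun x hx => ?_⟩
  have hL0 : 0 ≤ Real.log x := Real.log_nonneg hx
  have hx0 : 0 < x := by linarith
  have hplog : ∀ p ∈ Nat.primesLE ⌊x⌋₊, 1 ≤ (p : ℝ) ∧ (p : ℝ) ≤ x ∧ 0 ≤ Real.log p ∧
      Real.log p ≤ Real.log x := by
    intro p hp
    have h1 : (1 : ℝ) ≤ p := by exact_mod_cast (Nat.one_lt_of_mem_primesLE hp).le
    have h2 : (p : ℝ) ≤ x := (Nat.le_floor_iff hx0.le).mp (Nat.le_of_mem_primesLE hp)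
    exact ⟨h1, h2, Real.log_nonneg h1, Real.log_le_log (by linarith) h2⟩
  unfold meanError
  split_ifs with hl
  · subst hl
    calc ∑ p ∈ Nat.primesLE ⌊x⌋₊, Real.log p ^ (j + 1) * 1
        ≤ ∑ p ∈ Nat.primesLE ⌊x⌋₊, (1 + Real.log x) ^ j * Real.log p := by
          refine Finset.sum_le_sum fun p hp => ?_
          obtain ⟨-, -, h3, h4⟩ := hplog p hp
          rw [mul_one, pow_succ]
          gcongr
          linarith
      _ ≤ (1 + Real.log x) ^ j * (2 * x) := by
          rw [← Finset.mul_sum]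
          gcongr
          have := sum_log_primesLE_le ⌊x⌋₊
          linarith [Nat.floor_le hx0.le]
      _ ≤ _ := by
          rw [add_zero]
          have : 0 ≤ x * (1 + Real.log x) ^ j := by positivity
          nlinarith
  · obtain ⟨m, rfl⟩ := Nat.exists_eq_succ_of_ne_zero hl
    have hsum : ∑ p ∈ Nat.primesLE ⌊x⌋₊, Real.log p / p ≤ (C + 1) * (1 + Real.log x) := by
      have := (abs_le.mp (hM x hx)).2
      nlinarith
    calc ∑ p ∈ Nat.primesLE ⌊x⌋₊,
          Real.log p ^ (j + 1) * (x / p * (1 + Real.log (x / p)) ^ (m.succ - 1))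
        ≤ ∑ p ∈ Nat.primesLE ⌊x⌋₊, x * (1 + Real.log x) ^ (j + m) * (Real.log p / p) := by
          refine Finset.sum_le_sum fun p hp => ?_
          obtain ⟨h1, h2, h3, h4⟩ := hplog p hp
          have hp0 : (0 : ℝ) < p := by linarith
          have h5 : 0 ≤ Real.log (x / p) := Real.log_nonneg ((one_le_div hp0).mpr h2)
          have h6 : Real.log (x / p) ≤ Real.log x := by
            rw [Real.log_div hx0.ne' hp0.ne']; linarith
          calc Real.log p ^ (j + 1) * (x / p * (1 + Real.log (x / p)) ^ (m.succ - 1))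
              = x * (Real.log p ^ j * (1 + Real.log (x / p)) ^ m) * (Real.log p / p) := by
                rw [Nat.succ_sub_one]; ring
            _ ≤ x * ((1 + Real.log x) ^ j * (1 + Real.log x) ^ m) * (Real.log p / p) := by
                gcongr
                linarith
            _ = _ := by rw [pow_add]
      _ ≤ x * (1 + Real.log x) ^ (j + m) * ((C + 1) * (1 + Real.log x)) := by
          rw [← Finset.mul_sum]
          gcongr
      _ = (C + 1) * (x * (1 + Real.log x) ^ (j + m.succ)) := by
          rw [Nat.succ_eq_add_one, ← add_assoc, pow_succ]; ring
      _ ≤ _ := by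
          have : 0 ≤ x * (1 + Real.log x) ^ (j + m.succ) := by positivity
          nlinarith

/-! ### The recurrence for logarithmic moments -/

theorem mul_mulSingle_mem_finMulAntidiag {k n p : ℕ} (hp : p ≠ 0) (j : Fin k) {d : Fin k → ℕ}
    (hd : d ∈ Nat.finMulAntidiag k n) : d * Pi.mulSingle j p ∈ Nat.finMulAntidiag k (p * n) := by
  rw [Nat.mem_finMulAntidiag] at hd ⊢
  refine ⟨?_, mul_ne_zero hp hd.2⟩
  simp only [Pi.mul_apply, Finset.prod_mul_distrib, hd.1, Finset.prod_pi_mulSingle',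
    Finset.mem_univ, if_true]
  ring

/-- A factorization of `p n` with `p ∤ n` puts `p` on exactly one of the factors of a
factorization of `n`. -/
theorem sum_finMulAntidiag_prime_mul {k n p : ℕ} (hp : p.Prime) (hpn : ¬ p ∣ n)
    (φ : (Fin k → ℕ) → ℝ) :
    ∑ d ∈ Nat.finMulAntidiag k (p * n), φ d =
      ∑ j, ∑ d ∈ Nat.finMulAntidiag k n, φ (d * Pi.mulSingle j p) := by
  rw [← Finset.sum_product']
  symm
  have hdvd : ∀ {d : Fin k → ℕ}, d ∈ Nat.finMulAntidiag k n → ∀ i, ¬ p ∣ d i := fun hd i h =>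
    hpn (h.trans (Nat.dvd_of_mem_finMulAntidiag hd i))
  refine Finset.sum_bij (fun q _ => q.2 * Pi.mulSingle q.1 p) ?_ ?_ ?_ ?_
  · rintro ⟨j, d⟩ hq
    exact mul_mulSingle_mem_finMulAntidiag hp.ne_zero j (Finset.mem_product.mp hq).2
  · rintro ⟨j, d⟩ hq ⟨j', d'⟩ hq' h
    have hd := (Finset.mem_product.mp hq).2
    have hd' := (Finset.mem_product.mp hq').2
    have hj : j = j' := by
      by_contra hne
      have := congrFun h j
      simp only [Pi.mul_apply, Pi.mulSingle_eq_same, Pi.mulSingle_eq_of_ne hne, mul_one] at this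
      exact hdvd hd' j ⟨d j, this.symm.trans (mul_comm _ _)⟩
    subst hj
    refine Prod.ext rfl (funext fun i => ?_)
    have := congrFun h i
    simp only [Pi.mul_apply] at this
    refine Nat.eq_of_mul_eq_mul_right ?_ this
    rcases eq_or_ne i j with rfl | hne
    · simpa using hp.pos
    · simp [Pi.mulSingle_eq_of_ne hne]
  · intro d hd
    have hprod := Nat.prod_eq_of_mem_finMulAntidiag hd
    obtain ⟨j, -, e, he⟩ : ∃ j ∈ Finset.univ, p ∣ d j :=
      (hp.prime.dvd_finsetProd_iff d).mp (by rw [hprod]; exact dvd_mul_right p n)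
    have hupd : Function.update d j e * Pi.mulSingle j p = d := by
      funext i
      rcases eq_or_ne i j with rfl | hne
      · simp [he, mul_comm]
      · simp [hne]
    refine ⟨(j, Function.update d j e), ?_, hupd⟩
    rw [Finset.mem_product]
    refine ⟨Finset.mem_univ _, Nat.mem_finMulAntidiag.mpr ⟨?_, ?_⟩⟩
    · rw [← hupd] at hprod
      simp only [Pi.mul_apply, Finset.prod_mul_distrib, Finset.prod_pi_mulSingle',
        Finset.mem_univ, if_true] at hprod
      exact Nat.eq_of_mul_eq_mul_right hp.pos (by rw [hprod, mul_comm])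
    · rintro rfl
      simp at hpn
  · intros; rfl

/-- The mean of `φ` over the ordered factorizations of `n` into `k` factors. -/
def factorizationMean (k n : ℕ) (φ : (Fin k → ℕ) → ℝ) : ℝ :=
  (∑ d ∈ Nat.finMulAntidiag k n, φ d) / (Nat.finMulAntidiag k n).card

theorem card_finMulAntidiag_prime_mul {k n p : ℕ} (hp : p.Prime) (hpn : ¬ p ∣ n) :
    ((Nat.finMulAntidiag k (p * n)).card : ℝ) = k * (Nat.finMulAntidiag k n).card := by
  have := sum_finMulAntidiag_prime_mul (k := k) hp hpn fun _ => 1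
  simpa using this

theorem factorizationMean_congr {k n : ℕ} {φ ψ : (Fin k → ℕ) → ℝ}
    (h : ∀ d ∈ Nat.finMulAntidiag k n, φ d = ψ d) :
    factorizationMean k n φ = factorizationMean k n ψ := by
  rw [factorizationMean, factorizationMean, Finset.sum_congr rfl h]

theorem factorizationMean_sum {ι : Type*} (s : Finset ι) (k n : ℕ)
    (φ : ι → (Fin k → ℕ) → ℝ) :
    factorizationMean k n (fun d => ∑ i ∈ s, φ i d) = ∑ i ∈ s, factorizationMean k n (φ i) := by
  simp only [factorizationMean]
  rw [Finset.sum_comm, Finset.sum_div]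

theorem factorizationMean_const_mul (k n : ℕ) (c : ℝ) (φ : (Fin k → ℕ) → ℝ) :
    factorizationMean k n (fun d => c * φ d) = c * factorizationMean k n φ := by
  simp only [factorizationMean]
  rw [← Finset.mul_sum, mul_div_assoc]

theorem factorizationMean_nonneg {k n : ℕ} {φ : (Fin k → ℕ) → ℝ}
    (h : ∀ d ∈ Nat.finMulAntidiag k n, 0 ≤ φ d) : 0 ≤ factorizationMean k n φ :=
  div_nonneg (Finset.sum_nonneg h) (Nat.cast_nonneg _)

theorem factorizationMean_le {k n : ℕ} {φ : (Fin k → ℕ) → ℝ} {B : ℝ} (hB : 0 ≤ B)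
    (h : ∀ d ∈ Nat.finMulAntidiag k n, φ d ≤ B) : factorizationMean k n φ ≤ B := by
  refine div_le_of_le_mul₀ (Nat.cast_nonneg _) hB ?_
  calc _ ≤ ∑ d ∈ Nat.finMulAntidiag k n, B := Finset.sum_le_sum h
    _ = _ := by rw [Finset.sum_const, nsmul_eq_mul, mul_comm]

/-- As `p ∤ n`, `v_p(dᵢ)` is the indicator that `p` falls on the `i`-th factor, an event of
probability `1 / k` independent of the rest. This is the origin of the Dirichlet parameter `1 / k`.
-/
theorem factorizationMean_prime_mul {k n p : ℕ} (hp : p.Prime) (hpn : ¬ p ∣ n) (i : Fin k)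
    (φ : (Fin k → ℕ) → ℝ) :
    factorizationMean k (p * n) (fun d => ((d i).factorization p : ℝ) * φ d) =
      1 / k * factorizationMean k n (fun d => φ (d * Pi.mulSingle i p)) := by
  rw [factorizationMean, card_finMulAntidiag_prime_mul hp hpn,
    sum_finMulAntidiag_prime_mul hp hpn]
  have h : ∀ j, ∑ d ∈ Nat.finMulAntidiag k n,
      (((d * Pi.mulSingle j p : Fin k → ℕ) i).factorization p : ℝ) *
        φ (d * Pi.mulSingle j p) =
      if j = i then ∑ d ∈ Nat.finMulAntidiag k n, φ (d * Pi.mulSingle i p) else 0 := by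
    intro j
    have hz : ∀ d ∈ Nat.finMulAntidiag k n, (d i).factorization p = 0 := fun d hd =>
      Nat.factorization_eq_zero_of_not_dvd fun h =>
        hpn (h.trans (Nat.dvd_of_mem_finMulAntidiag hd i))
    split_ifs with hj
    · subst hj
      refine Finset.sum_congr rfl fun d hd => ?_
      have hd0 : d j ≠ 0 := Nat.ne_zero_of_mem_finMulAntidiag hd j
      rw [Pi.mul_apply, Pi.mulSingle_eq_same, Nat.factorization_mul hd0 hp.ne_zero,
        Finsupp.add_apply, hz d hd, hp.factorization_self]
      simp
    · refine Finset.sum_eq_zero fun d hd => ?_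
      rw [Pi.mul_apply, Pi.mulSingle_eq_of_ne (Ne.symm hj), mul_one, hz d hd]
      simp
  rw [Finset.sum_congr rfl fun j _ => h j, Finset.sum_ite_eq' Finset.univ i]
  simp only [Finset.mem_univ, if_true, factorizationMean]
  rw [div_mul_div_comm, one_mul]

/-- The monomial `∏ (log dᵢ) ^ aᵢ`. -/
def logMonomial {k : ℕ} (a d : Fin k → ℕ) : ℝ := ∏ i, Real.log (d i) ^ a i

theorem logMonomial_nonneg {k : ℕ} (a d : Fin k → ℕ) : 0 ≤ logMonomial a d :=
  Finset.prod_nonneg fun _ _ => pow_nonneg (Real.log_natCast_nonneg _) _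

theorem logMonomial_le {k n : ℕ} (a : Fin k → ℕ) {d : Fin k → ℕ}
    (hd : d ∈ Nat.finMulAntidiag k n) : logMonomial a d ≤ Real.log n ^ ∑ i, a i := by
  rw [← Finset.prod_pow_eq_pow_sum]
  refine Finset.prod_le_prod (fun i _ => pow_nonneg (Real.log_natCast_nonneg _) _) fun i _ => ?_
  have h0 : d i ≠ 0 := Nat.ne_zero_of_mem_finMulAntidiag hd i
  have hn : n ≠ 0 := (Nat.mem_finMulAntidiag.mp hd).2
  refine pow_le_pow_left₀ (Real.log_natCast_nonneg _) (Real.log_le_log ?_ ?_) _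
  · exact_mod_cast Nat.pos_of_ne_zero h0
  · exact_mod_cast Nat.le_of_dvd (Nat.pos_of_ne_zero hn) (Nat.dvd_of_mem_finMulAntidiag hd i)

theorem logMonomial_update {k : ℕ} (a d : Fin k → ℕ) (i : Fin k) (r : ℕ) :
    logMonomial (Function.update a i r) d =
      Real.log (d i) ^ r * ∏ j ∈ Finset.univ.erase i, Real.log (d j) ^ a j := by
  rw [logMonomial, ← Finset.mul_prod_erase _ _ (Finset.mem_univ i), Function.update_self]
  congr 1
  refine Finset.prod_congr rfl fun j hj => ?_
  rw [Function.update_of_ne (Finset.ne_of_mem_erase hj)]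

theorem logMonomial_update_succ {k : ℕ} (a d : Fin k → ℕ) (i : Fin k) (s : ℕ) :
    logMonomial (Function.update a i (s + 1)) d =
      Real.log (d i) * logMonomial (Function.update a i s) d := by
  rw [logMonomial_update, logMonomial_update]; ring

theorem logMonomial_update_mul_mulSingle {k p : ℕ} (hp : p ≠ 0) (a : Fin k → ℕ) {d : Fin k → ℕ}
    (i : Fin k) (hd : d i ≠ 0) (s : ℕ) :
    logMonomial (Function.update a i s) (d * Pi.mulSingle i p) =
      ∑ r ∈ Finset.range (s + 1), s.choose r * Real.log p ^ (s - r) *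
        logMonomial (Function.update a i r) d := by
  have h : ∏ j ∈ Finset.univ.erase i, Real.log ((d * Pi.mulSingle i p : Fin k → ℕ) j) ^ a j =
      ∏ j ∈ Finset.univ.erase i, Real.log (d j) ^ a j := by
    refine Finset.prod_congr rfl fun j hj => ?_
    rw [Pi.mul_apply, Pi.mulSingle_eq_of_ne (Finset.ne_of_mem_erase hj), mul_one]
  rw [logMonomial_update, h, Pi.mul_apply, Pi.mulSingle_eq_same, Nat.cast_mul,
    Real.log_mul (by exact_mod_cast hd) (by exact_mod_cast hp), add_pow, Finset.sum_mul]
  refine Finset.sum_congr rfl fun r _ => ?_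
  rw [logMonomial_update]; ring

theorem log_eq_sum_primeFactors {n e : ℕ} (hn : n ≠ 0) (he : e ∣ n) :
    Real.log e = ∑ p ∈ n.primeFactors, (e.factorization p : ℝ) * Real.log p := by
  rw [Real.log_nat_eq_sum_factorization, Finsupp.sum, Nat.support_factorization]
  refine Finset.sum_subset (Nat.primeFactors_mono he hn) fun p _ hp => ?_
  rw [← Nat.support_factorization, Finsupp.notMem_support_iff] at hp
  rw [hp]; simp

/-- Peeling off one logarithm: only repeated prime factors cause an error. -/
theorem abs_factorizationMean_log_mul_sub_le {k n : ℕ} (hk : 0 < k) (hn : n ≠ 0) (a : Fin k → ℕ)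
    (i : Fin k) :
    |factorizationMean k n (fun d => Real.log (d i) * logMonomial a d) -
      ∑ p ∈ n.primeFactors, Real.log p * (1 / k *
        factorizationMean k (n / p) (fun d => logMonomial a (d * Pi.mulSingle i p)))| ≤
      (∑ p ∈ n.primeFactors with p ^ 2 ∣ n, (n.factorization p : ℝ) * Real.log p) *
        Real.log n ^ ∑ i, a i := by
  set m := ∑ i, a i with hm
  have hlogn : 0 ≤ Real.log n := Real.log_natCast_nonneg n
  have h1 : factorizationMean k n (fun d => Real.log (d i) * logMonomial a d) =
      ∑ p ∈ n.primeFactors, Real.log p *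
        factorizationMean k n (fun d => ((d i).factorization p : ℝ) * logMonomial a d) := by
    simp_rw [← factorizationMean_const_mul]
    rw [← factorizationMean_sum]
    refine factorizationMean_congr fun d hd => ?_
    rw [log_eq_sum_primeFactors hn (Nat.dvd_of_mem_finMulAntidiag hd i), Finset.sum_mul]
    exact Finset.sum_congr rfl fun p _ => by ring
  rw [h1, ← Finset.sum_sub_distrib, Finset.sum_mul, Finset.sum_filter]
  refine (Finset.abs_sum_le_sum_abs _ _).trans (Finset.sum_le_sum fun p hp => ?_)
  obtain ⟨hpp, hpn, -⟩ := Nat.mem_primeFactors.mp hp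
  have hlogp : 0 ≤ Real.log p := Real.log_natCast_nonneg p
  have hnp : p * (n / p) = n := Nat.mul_div_cancel' hpn
  have hv1 : (1 : ℝ) ≤ n.factorization p := by
    exact_mod_cast hpp.factorization_pos_of_dvd hn hpn
  rw [← mul_sub, abs_mul, abs_of_nonneg hlogp]
  split_ifs with h2
  -- For `p ^ 2 ∣ n` no identity is available, but both compared quantities lie between `0` and
  -- `v_p(n) (log n) ^ m`.
  · have hA0 : 0 ≤ factorizationMean k n
        (fun d => ((d i).factorization p : ℝ) * logMonomial a d) :=
      factorizationMean_nonneg fun d _ => mul_nonneg (Nat.cast_nonneg _) (logMonomial_nonneg _ _)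
    have hA1 : factorizationMean k n (fun d => ((d i).factorization p : ℝ) * logMonomial a d) ≤
        n.factorization p * Real.log n ^ m := by
      refine factorizationMean_le (by positivity) fun d hd => ?_
      refine mul_le_mul ?_ (logMonomial_le a hd) (logMonomial_nonneg _ _) (Nat.cast_nonneg _)
      exact_mod_cast (Nat.factorization_le_iff_dvd (Nat.ne_zero_of_mem_finMulAntidiag hd i) hn).mpr
        (Nat.dvd_of_mem_finMulAntidiag hd i) p
    have hB0 : 0 ≤ factorizationMean k (n / p)
        (fun d => logMonomial a (d * Pi.mulSingle i p)) :=
      factorizationMean_nonneg fun d _ => logMonomial_nonneg _ _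
    have hB1 : factorizationMean k (n / p) (fun d => logMonomial a (d * Pi.mulSingle i p)) ≤
        Real.log n ^ m := by
      refine factorizationMean_le (by positivity) fun d hd => ?_
      have := mul_mulSingle_mem_finMulAntidiag hpp.ne_zero i hd
      rw [hnp] at this
      exact logMonomial_le a this
    have hk1 : (1 : ℝ) / k ≤ 1 := by
      rw [div_le_one (by exact_mod_cast hk)]; exact_mod_cast hk
    have hk0 : (0 : ℝ) ≤ 1 / k := by positivity
    set B := factorizationMean k (n / p) (fun d => logMonomial a (d * Pi.mulSingle i p))
    have hB2 : 1 / k * B ≤ n.factorization p * Real.log n ^ m := by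
      have hpow : 0 ≤ Real.log n ^ m := by positivity
      nlinarith
    have hB3 : 0 ≤ 1 / k * B := mul_nonneg hk0 hB0
    calc _ ≤ Real.log p * (n.factorization p * Real.log n ^ m) := by
          refine mul_le_mul_of_nonneg_left ?_ hlogp
          rw [abs_le]; constructor <;> linarith
      _ = _ := by ring
  -- When `p` divides `n` exactly once the two terms agree, so there is no error.
  · have hnd : ¬ p ∣ n / p := by
      rintro ⟨e, he⟩
      exact h2 ⟨e, by rw [← hnp, he]; ring⟩
    have := factorizationMean_prime_mul hpp hnd i (logMonomial a)
    rw [hnp] at this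
    rw [this]; simp

/-- The mean of `∏ (log dᵢ) ^ aᵢ` over the ordered factorizations of `n`. -/
def logMoment {k : ℕ} (a : Fin k → ℕ) (n : ℕ) : ℝ := factorizationMean k n (logMonomial a)

/-- The substitution `n = p n'`. Multiples of `p` are allowed for `n'`, so the inner sums run over
full intervals and the induction hypothesis applies to them. -/
theorem sum_primeFactors_div_eq (N : ℕ) (φ : ℕ → ℕ → ℝ) :
    ∑ n ∈ Finset.Icc 1 N, ∑ p ∈ n.primeFactors, φ p (n / p) =
      ∑ p ∈ Nat.primesLE N, ∑ n ∈ Finset.Icc 1 (N / p), φ p n := by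
  rw [Finset.sum_sigma', Finset.sum_sigma']
  refine Finset.sum_bij' (fun q _ => ⟨q.2, q.1 / q.2⟩) (fun q _ => ⟨q.1 * q.2, q.1⟩) ?_ ?_ ?_ ?_ ?_
  · rintro ⟨n, p⟩ h
    simp only [Finset.mem_sigma, Finset.mem_Icc, Nat.mem_primeFactors, Nat.mem_primesLE] at h ⊢
    obtain ⟨⟨h1, h2⟩, hp, hd, -⟩ := h
    exact ⟨⟨(Nat.le_of_dvd h1 hd).trans h2, hp⟩, Nat.div_pos (Nat.le_of_dvd h1 hd) hp.pos,
      Nat.div_le_div_right h2⟩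
  · rintro ⟨p, n⟩ h
    simp only [Finset.mem_sigma, Finset.mem_Icc, Nat.mem_primeFactors, Nat.mem_primesLE] at h ⊢
    obtain ⟨⟨-, hp⟩, h1, h2⟩ := h
    have h3 : 0 < p * n := Nat.mul_pos hp.pos h1
    exact ⟨⟨h3, by rw [mul_comm]; exact (Nat.le_div_iff_mul_le hp.pos).mp h2⟩, hp,
      dvd_mul_right p n, h3.ne'⟩
  · rintro ⟨n, p⟩ h
    simp only [Finset.mem_sigma, Nat.mem_primeFactors] at h
    simp only [Nat.mul_div_cancel' h.2.2.1]
  · rintro ⟨p, n⟩ h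
    simp only [Finset.mem_sigma, Nat.mem_primesLE] at h
    simp only [Nat.mul_div_cancel_left n h.1.2.pos]
  · intros; rfl

theorem factorizationMean_logMonomial_update_mul_mulSingle {k p : ℕ} (hp : p ≠ 0)
    (a : Fin k → ℕ) (i : Fin k) (s n : ℕ) :
    factorizationMean k n
      (fun d => logMonomial (Function.update a i s) (d * Pi.mulSingle i p)) =
      ∑ r ∈ Finset.range (s + 1), s.choose r * Real.log p ^ (s - r) *
        logMoment (Function.update a i r) n := by
  simp only [logMoment]
  simp_rw [← factorizationMean_const_mul]
  rw [← factorizationMean_sum]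
  exact factorizationMean_congr fun d hd =>
    logMonomial_update_mul_mulSingle hp a i (Nat.ne_zero_of_mem_finMulAntidiag hd i) s

/-- The recurrence for the summatory functions of the logarithmic moments. -/
theorem exists_abs_sum_logMoment_sub_le {k : ℕ} (hk : 0 < k) :
    ∃ C : ℝ, 0 ≤ C ∧ ∀ (a : Fin k → ℕ) (i : Fin k) (s N : ℕ),
      |∑ n ∈ Finset.Icc 1 N, logMoment (Function.update a i (s + 1)) n -
        1 / k * ∑ r ∈ Finset.range (s + 1), s.choose r * ∑ p ∈ Nat.primesLE N,
          Real.log p ^ (s - r + 1) *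
            ∑ n ∈ Finset.Icc 1 (N / p), logMoment (Function.update a i r) n| ≤
      C * N * Real.log N ^ ∑ j, Function.update a i s j := by
  obtain ⟨C, hC, hb⟩ := exists_sum_repeated_prime_le
  refine ⟨C, hC, fun a i s N => ?_⟩
  set b := Function.update a i s with hbdef
  have e1 : ∀ n, logMoment (Function.update a i (s + 1)) n =
      factorizationMean k n (fun d => Real.log (d i) * logMonomial b d) := fun n =>
    factorizationMean_congr fun d _ => logMonomial_update_succ a d i s
  -- The exponent `s - r + 1` collects the peeled `log p` and the `s - r` copies from the binomial
  -- expansion.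
  have e2 : 1 / k * ∑ r ∈ Finset.range (s + 1), s.choose r * ∑ p ∈ Nat.primesLE N,
          Real.log p ^ (s - r + 1) *
            ∑ n ∈ Finset.Icc 1 (N / p), logMoment (Function.update a i r) n =
      ∑ n ∈ Finset.Icc 1 N, ∑ p ∈ n.primeFactors, Real.log p * (1 / k *
        factorizationMean k (n / p) (fun d => logMonomial b (d * Pi.mulSingle i p))) := by
    rw [sum_primeFactors_div_eq N fun p n => Real.log p * (1 / k *
        factorizationMean k n
          (fun d => logMonomial b (d * Pi.mulSingle (M := fun _ => ℕ) i p)))]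
    simp_rw [Finset.mul_sum]
    rw [Finset.sum_comm]
    refine Finset.sum_congr rfl fun p hp => ?_
    rw [Finset.sum_comm]
    refine Finset.sum_congr rfl fun n _ => ?_
    rw [factorizationMean_logMonomial_update_mul_mulSingle
      (Nat.prime_of_mem_primesLE hp).ne_zero, Finset.mul_sum, Finset.mul_sum]
    exact Finset.sum_congr rfl fun r _ => by ring
  rw [e2, Finset.sum_congr rfl fun n _ => e1 n, ← Finset.sum_sub_distrib]
  refine (Finset.abs_sum_le_sum_abs _ _).trans ?_
  calc _ ≤ ∑ n ∈ Finset.Icc 1 N, (∑ p ∈ n.primeFactors with p ^ 2 ∣ n,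
        (n.factorization p : ℝ) * Real.log p) * Real.log N ^ ∑ i, b i := by
        refine Finset.sum_le_sum fun n hn => ?_
        rw [Finset.mem_Icc] at hn
        refine (abs_factorizationMean_log_mul_sub_le hk (by omega) b i).trans ?_
        refine mul_le_mul_of_nonneg_left (pow_le_pow_left₀ (Real.log_natCast_nonneg _)
          (Real.log_le_log (by exact_mod_cast hn.1) (by exact_mod_cast hn.2)) _) ?_
        exact Finset.sum_nonneg fun p _ =>
          mul_nonneg (Nat.cast_nonneg _) (Real.log_natCast_nonneg _)
    _ ≤ _ := by
        rw [← Finset.sum_mul]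
        exact mul_le_mul_of_nonneg_right (hb N) (pow_nonneg (Real.log_natCast_nonneg _) _)

/-! ### Mean values of logarithmic moments -/

/-- `F` has mean value `D (log x) ^ l` with the admissible error. -/
def HasLogMean (F : ℕ → ℝ) (D : ℝ) (l : ℕ) : Prop :=
  ∃ C : ℝ, 0 ≤ C ∧ ∀ x : ℝ, 1 ≤ x → |F ⌊x⌋₊ - D * x * Real.log x ^ l| ≤ C * meanError l x

/-- Because `⌊x⌋₊ / p = ⌊x / p⌋₊`, the mean value of `F` can be inserted at `x / p`; partial
summation over `p` then evaluates the main term. -/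
theorem HasLogMean.sum_primesLE {F : ℕ → ℝ} {D : ℝ} {l : ℕ} (hF : HasLogMean F D l) (j : ℕ) :
    ∃ C : ℝ, 0 ≤ C ∧ ∀ x : ℝ, 1 ≤ x →
      |∑ p ∈ Nat.primesLE ⌊x⌋₊, Real.log p ^ (j + 1) * F (⌊x⌋₊ / p) -
        D * ((j.factorial * l.factorial : ℝ) / (j + l + 1).factorial) * x *
          Real.log x ^ (j + l + 1)| ≤ C * (x * (1 + Real.log x) ^ (j + l)) := by
  obtain ⟨C, hC, hb⟩ := hF
  obtain ⟨C₁, hC₁, hb₁⟩ := exists_sum_log_pow_mul_meanError_le j l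
  obtain ⟨C₂, hC₂, hb₂⟩ := exists_abs_sum_log_div_mul_sub_integral_le j l
  refine ⟨C * C₁ + |D| * C₂, by positivity, fun x hx => ?_⟩
  have hx0 : 0 < x := by linarith
  set B := (j.factorial * l.factorial : ℝ) / (j + l + 1).factorial
  set S := ∑ p ∈ Nat.primesLE ⌊x⌋₊, Real.log p ^ (j + 1) / p * Real.log (x / p) ^ l with hS
  have h1 : |∑ p ∈ Nat.primesLE ⌊x⌋₊, Real.log p ^ (j + 1) * F (⌊x⌋₊ / p) - D * x * S| ≤
      C * (C₁ * (x * (1 + Real.log x) ^ (j + l))) := by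
    rw [hS, Finset.mul_sum, ← Finset.sum_sub_distrib]
    refine (Finset.abs_sum_le_sum_abs _ _).trans ?_
    refine le_trans (Finset.sum_le_sum fun p hp => ?_)
      (le_trans (le_of_eq (Finset.mul_sum _ _ C).symm) (mul_le_mul_of_nonneg_left (hb₁ x hx) hC))
    have hp1 : (0 : ℝ) < p := by exact_mod_cast (Nat.prime_of_mem_primesLE hp).pos
    have hpx : (p : ℝ) ≤ x := (Nat.le_floor_iff hx0.le).mp (Nat.le_of_mem_primesLE hp)
    have hxp : 1 ≤ x / p := (one_le_div hp1).mpr hpx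
    have hlog : 0 ≤ Real.log p ^ (j + 1) := pow_nonneg (Real.log_natCast_nonneg _) _
    have e : Real.log p ^ (j + 1) * F (⌊x⌋₊ / p) -
        D * x * (Real.log p ^ (j + 1) / p * Real.log (x / p) ^ l) =
        Real.log p ^ (j + 1) * (F ⌊x / p⌋₊ - D * (x / p) * Real.log (x / p) ^ l) := by
      rw [Nat.floor_div_natCast]; ring
    rw [e, abs_mul, abs_of_nonneg hlog]
    calc _ ≤ Real.log p ^ (j + 1) * (C * meanError l (x / p)) :=
          mul_le_mul_of_nonneg_left (hb _ hxp) hlog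
      _ = _ := by ring
  have h2 : |D * x * S - D * B * x * Real.log x ^ (j + l + 1)| ≤
      |D| * x * (C₂ * (1 + Real.log x) ^ (j + l)) := by
    have e : D * x * S - D * B * x * Real.log x ^ (j + l + 1) =
        D * x * (S - B * Real.log x ^ (j + l + 1)) := by ring
    rw [e, abs_mul, abs_mul, abs_of_pos hx0]
    exact mul_le_mul_of_nonneg_left (hb₂ x hx) (by positivity)
  calc _ ≤ _ := abs_sub_le _ (D * x * S) _
    _ ≤ _ := add_le_add h1 h2
    _ = _ := by ring

/-- The moment `E ∏ Xᵢ ^ aᵢ` of the symmetric Dirichlet distribution with parameters `1 / k`. -/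
def dirichletMoment {k : ℕ} (a : Fin k → ℕ) : ℝ :=
  -- The parameters sum to `1`, so the usual denominator `Γ(1 + m) / Γ(1)` is `m!`.
  (∏ i, Real.Gamma (1 / k + a i) / Real.Gamma (1 / k)) / (∑ i, a i).factorial

/-- Telescopes: `Γ(θ + s + 2) / (s + 1)! - Γ(θ + s + 1) / s! = θ Γ(θ + s + 1) / (s + 1)!`. -/
theorem mul_sum_Gamma_div_factorial {θ : ℝ} (hθ : 0 < θ) (s : ℕ) :
    θ * ∑ r ∈ Finset.range (s + 1), Real.Gamma (θ + r) / r.factorial =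
      Real.Gamma (θ + (s + 1 : ℕ)) / s.factorial := by
  induction s with
  | zero => simp [Real.Gamma_add_one hθ.ne']
  | succ s ih =>
    rw [Finset.sum_range_succ, mul_add, ih]
    have hne : θ + (s + 1 : ℕ) ≠ 0 := by positivity
    have e : θ + ((s + 1 + 1 : ℕ) : ℝ) = θ + (s + 1 : ℕ) + 1 := by push_cast; ring
    rw [e, Real.Gamma_add_one hne, Nat.factorial_succ]
    have : (s.factorial : ℝ) ≠ 0 := by exact_mod_cast s.factorial_ne_zero
    push_cast
    field_simp
    ring

theorem sum_update_eq {k : ℕ} (a : Fin k → ℕ) (i : Fin k) (r : ℕ) :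
    ∑ j, Function.update a i r j = r + ∑ j ∈ Finset.univ.erase i, a j := by
  rw [← Finset.add_sum_erase _ _ (Finset.mem_univ i), Function.update_self]
  congr 1
  exact Finset.sum_congr rfl fun j hj => Function.update_of_ne (Finset.ne_of_mem_erase hj) _ _

theorem dirichletMoment_update {k : ℕ} (a : Fin k → ℕ) (i : Fin k) (r : ℕ) :
    dirichletMoment (Function.update a i r) =
      Real.Gamma (1 / k + r) / Real.Gamma (1 / k) *
        (∏ j ∈ Finset.univ.erase i, Real.Gamma (1 / k + a j) / Real.Gamma (1 / k)) /
          (r + ∑ j ∈ Finset.univ.erase i, a j).factorial := by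
  rw [dirichletMoment, sum_update_eq, ← Finset.mul_prod_erase _ _ (Finset.mem_univ i),
    Function.update_self]
  congr 2
  refine Finset.prod_congr rfl fun j hj => ?_
  rw [Function.update_of_ne (Finset.ne_of_mem_erase hj)]

/-- The factorial in the Beta value cancels the denominator of the lower moment, and the binomial
coefficient leaves `Γ(1 / k + r) / r!` times a factor free of `r`; the telescoping Gamma identity
sums these. -/
theorem dirichletMoment_update_succ {k : ℕ} (hk : 0 < k) (a : Fin k → ℕ) (i : Fin k) (s : ℕ) :
    dirichletMoment (Function.update a i (s + 1)) =
      1 / k * ∑ r ∈ Finset.range (s + 1), s.choose r *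
        (dirichletMoment (Function.update a i r) *
          (((s - r).factorial * (∑ j, Function.update a i r j).factorial : ℝ) /
            (s - r + (∑ j, Function.update a i r j) + 1).factorial)) := by
  have hk' : (0 : ℝ) < 1 / k := by positivity
  obtain ⟨R, hR⟩ : ∃ R, R = ∑ j ∈ Finset.univ.erase i, a j := ⟨_, rfl⟩
  obtain ⟨P, hP⟩ : ∃ P, P = ∏ j ∈ Finset.univ.erase i,
    Real.Gamma (1 / k + a j) / Real.Gamma (1 / k) := ⟨_, rfl⟩
  have hupd := dirichletMoment_update a i
  rw [← hR, ← hP] at hupd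
  have hG : Real.Gamma (1 / k) ≠ 0 := (Real.Gamma_pos_of_pos hk').ne'
  have hterm : ∀ r ∈ Finset.range (s + 1), s.choose r *
        (dirichletMoment (Function.update a i r) *
          (((s - r).factorial * (∑ j, Function.update a i r j).factorial : ℝ) /
            (s - r + (∑ j, Function.update a i r j) + 1).factorial)) =
      s.factorial * P / Real.Gamma (1 / k) / (s + 1 + R).factorial *
        (Real.Gamma (1 / k + r) / r.factorial) := by
    intro r hr
    have hrs : r ≤ s := by rw [Finset.mem_range] at hr; omega
    rw [hupd, sum_update_eq, ← hR,
      show s - r + (r + R) + 1 = s + 1 + R by omega]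
    have hch : (s.choose r : ℝ) * r.factorial * (s - r).factorial = s.factorial := by
      exact_mod_cast Nat.choose_mul_factorial_mul_factorial hrs
    have h1 : ((r + R).factorial : ℝ) ≠ 0 := by exact_mod_cast Nat.factorial_ne_zero _
    have h2 : ((s + 1 + R).factorial : ℝ) ≠ 0 := by exact_mod_cast Nat.factorial_ne_zero _
    have h3 : (r.factorial : ℝ) ≠ 0 := by exact_mod_cast Nat.factorial_ne_zero _
    rw [← hch]
    field_simp
  rw [Finset.sum_congr rfl hterm, ← Finset.mul_sum, mul_left_comm,
    mul_sum_Gamma_div_factorial hk', hupd]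
  have h2 : ((s + 1 + R).factorial : ℝ) ≠ 0 := by exact_mod_cast Nat.factorial_ne_zero _
  have h3 : (s.factorial : ℝ) ≠ 0 := by exact_mod_cast Nat.factorial_ne_zero _
  field_simp

theorem hasLogMean_logMoment_update_succ {k : ℕ} (hk : 0 < k) (a : Fin k → ℕ) (i : Fin k) (s : ℕ)
    (h : ∀ r ≤ s, HasLogMean
      (fun N => ∑ n ∈ Finset.Icc 1 N, logMoment (Function.update a i r) n)
      (dirichletMoment (Function.update a i r)) (∑ j, Function.update a i r j)) :
    HasLogMean (fun N => ∑ n ∈ Finset.Icc 1 N, logMoment (Function.update a i (s + 1)) n)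
      (dirichletMoment (Function.update a i (s + 1))) (∑ j, Function.update a i (s + 1) j) := by
  obtain ⟨C₀, hC₀, hb₀⟩ := exists_abs_sum_logMoment_sub_le hk
  -- The bound `r ≤ s` sits inside the existential so that `choose` yields a constant for every `r`.
  have hex : ∀ r : ℕ, ∃ C : ℝ, 0 ≤ C ∧ (r ≤ s → ∀ x : ℝ, 1 ≤ x →
      |∑ p ∈ Nat.primesLE ⌊x⌋₊, Real.log p ^ (s - r + 1) *
          ∑ n ∈ Finset.Icc 1 (⌊x⌋₊ / p), logMoment (Function.update a i r) n -
        dirichletMoment (Function.update a i r) *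
          (((s - r).factorial * (∑ j, Function.update a i r j).factorial : ℝ) /
            (s - r + (∑ j, Function.update a i r j) + 1).factorial) * x *
          Real.log x ^ (s - r + (∑ j, Function.update a i r j) + 1)| ≤
        C * (x * (1 + Real.log x) ^ (s - r + ∑ j, Function.update a i r j))) := by
    intro r
    by_cases hr : r ≤ s
    · obtain ⟨C, hC, hb⟩ := (h r hr).sum_primesLE (s - r)
      exact ⟨C, hC, fun _ => hb⟩
    · exact ⟨0, le_rfl, fun h => absurd h hr⟩
  choose C hC hb using hex
  set R := ∑ j ∈ Finset.univ.erase i, a j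
  set m := s + R with hm
  have hmr : ∀ r ≤ s, s - r + ∑ j, Function.update a i r j = m := by
    intro r hr; rw [sum_update_eq]; omega
  have hms : ∑ j, Function.update a i (s + 1) j = m + 1 := by rw [sum_update_eq]; omega
  refine ⟨C₀ + 1 / k * ∑ r ∈ Finset.range (s + 1), s.choose r * C r, ?_, fun x hx => ?_⟩
  · have : 0 ≤ ∑ r ∈ Finset.range (s + 1), (s.choose r : ℝ) * C r :=
      Finset.sum_nonneg fun r _ => mul_nonneg (Nat.cast_nonneg _) (hC r)
    positivity
  have hx0 : 0 < x := by linarith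
  have hL : 0 ≤ Real.log x := Real.log_nonneg hx
  rw [hms]
  have hme : meanError (m + 1) x = x * (1 + Real.log x) ^ m := by simp [meanError]
  rw [hme]
  have h1 := hb₀ a i s ⌊x⌋₊
  have h1' : C₀ * ⌊x⌋₊ * Real.log ⌊x⌋₊ ^ ∑ j, Function.update a i s j ≤
      C₀ * (x * (1 + Real.log x) ^ m) := by
    rw [show ∑ j, Function.update a i s j = m by rw [← hmr s le_rfl]; simp, mul_assoc]
    have hfl : (⌊x⌋₊ : ℝ) ≤ x := Nat.floor_le hx0.le
    have hfl1 : (0 : ℝ) < ⌊x⌋₊ := by exact_mod_cast (Nat.one_le_floor_iff x).mpr hx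
    have hlog : Real.log ⌊x⌋₊ ≤ 1 + Real.log x := by linarith [Real.log_le_log hfl1 hfl]
    have hlog0 : 0 ≤ Real.log ⌊x⌋₊ := Real.log_natCast_nonneg _
    gcongr
  set U := ∑ r ∈ Finset.range (s + 1), s.choose r * ∑ p ∈ Nat.primesLE ⌊x⌋₊,
    Real.log p ^ (s - r + 1) *
      ∑ n ∈ Finset.Icc 1 (⌊x⌋₊ / p), logMoment (Function.update a i r) n with hU
  have h2 : |1 / k * U - dirichletMoment (Function.update a i (s + 1)) * x *
      Real.log x ^ (m + 1)| ≤
      1 / k * ((∑ r ∈ Finset.range (s + 1), s.choose r * C r) * (x * (1 + Real.log x) ^ m)) := by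
    rw [dirichletMoment_update_succ hk, mul_assoc (1 / (k : ℝ)), mul_assoc (1 / (k : ℝ)),
      ← mul_sub, abs_mul, abs_of_nonneg (by positivity : (0 : ℝ) ≤ 1 / k), hU]
    refine mul_le_mul_of_nonneg_left ?_ (by positivity)
    rw [mul_assoc, Finset.sum_mul, Finset.sum_mul, ← Finset.sum_sub_distrib]
    refine (Finset.abs_sum_le_sum_abs _ _).trans (Finset.sum_le_sum fun r hr => ?_)
    have hrs : r ≤ s := by rw [Finset.mem_range] at hr; omega
    have := hb r hrs x hx
    rw [hmr r hrs] at this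
    rw [hmr r hrs, mul_assoc (s.choose r : ℝ), ← mul_sub, abs_mul,
      abs_of_nonneg (Nat.cast_nonneg _), mul_assoc (s.choose r : ℝ), ← mul_assoc _ x]
    exact mul_le_mul_of_nonneg_left this (Nat.cast_nonneg _)
  calc _ ≤ _ := abs_sub_le _ (1 / k * U) _
    _ ≤ _ := add_le_add (h1.trans h1') h2
    _ = _ := by ring

theorem factorizationMean_one {k n : ℕ} (hk : 0 < k) (hn : n ≠ 0) :
    factorizationMean k n (fun _ => 1) = 1 := by
  rw [factorizationMean, Finset.sum_const, nsmul_eq_mul, mul_one, div_self]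
  exact_mod_cast (finMulAntidiag_nonempty hk hn).card_ne_zero

/-- The mean value of the logarithmic moments. -/
theorem hasLogMean_logMoment {k : ℕ} (hk : 0 < k) (a : Fin k → ℕ) :
    HasLogMean (fun N => ∑ n ∈ Finset.Icc 1 N, logMoment a n) (dirichletMoment a)
      (∑ j, a j) := by
  induction hm : ∑ j, a j using Nat.strong_induction_on generalizing a with
  | _ m ih =>
    subst hm
    by_cases h0 : a = 0
    · subst h0
      refine ⟨1, zero_le_one, fun x hx => ?_⟩
      have hG : Real.Gamma (1 / k) ≠ 0 := (Real.Gamma_pos_of_pos (by positivity)).ne'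
      have hD : dirichletMoment (0 : Fin k → ℕ) = 1 := by
        simp only [dirichletMoment, Pi.zero_apply, Nat.cast_zero, add_zero]
        rw [div_self hG]; simp
      have hone : ∀ n ∈ Finset.Icc 1 ⌊x⌋₊, logMoment (0 : Fin k → ℕ) n = 1 := by
        intro n hn
        rw [Finset.mem_Icc] at hn
        rw [← factorizationMean_one hk (show n ≠ 0 by omega)]
        exact factorizationMean_congr fun d _ => by simp [logMonomial]
      beta_reduce
      rw [hD, Finset.sum_congr rfl hone]
      simp only [Finset.sum_const, Nat.card_Icc, Nat.add_sub_cancel, nsmul_eq_mul, mul_one,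
        Pi.zero_apply, mul_zero, pow_zero, one_mul, meanError, if_true]
      rw [abs_le]
      constructor <;> linarith [Nat.floor_le (show 0 ≤ x by linarith), Nat.lt_floor_add_one x]
    -- A positive exponent `aᵢ = s + 1` is lowered to each `r ≤ s`, which decreases the total
    -- degree.
    · obtain ⟨i, hi⟩ := Function.ne_iff.mp h0
      obtain ⟨s, hs⟩ := Nat.exists_eq_succ_of_ne_zero hi
      have hupd : Function.update a i (s + 1) = a := by
        rw [show s + 1 = a i from hs.symm, Function.update_eq_self]
      have := hasLogMean_logMoment_update_succ hk a i s fun r hr =>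
        ih _ (by
          conv_rhs => rw [← hupd]
          rw [sum_update_eq, sum_update_eq]; omega) _ rfl
      rwa [hupd] at this

/-! ### Dirichlet's integral -/

/-- The function `t ↦ t ^ (α - 1)` on `[0, ∞)`, extended by zero. -/
def powDensity (α t : ℝ) : ENNReal := if 0 ≤ t then ENNReal.ofReal (t ^ (α - 1)) else 0

theorem measurable_powDensity (α : ℝ) : Measurable (powDensity α) :=
  Measurable.ite measurableSet_Ici (by fun_prop) measurable_const

theorem powDensity_ne_top (α t : ℝ) : powDensity α t ≠ ⊤ := by
  unfold powDensity
  split_ifs <;> simp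

theorem lintegral_eq_mul_lintegral_comp_mul_left {s : ℝ} (hs : 0 < s) {f : ℝ → ENNReal}
    (hf : Measurable f) : ∫⁻ t, f t = ENNReal.ofReal s * ∫⁻ u, f (s * u) := by
  have h := Real.smul_map_volume_mul_left hs.ne'
  rw [abs_of_pos hs] at h
  conv_lhs => rw [← h]
  rw [lintegral_smul_measure, lintegral_map hf (by fun_prop), smul_eq_mul]

/-- For `s > 0`, scaling by `s` reduces the convolution to the total mass of the Beta law. The point
`s = 0` is excluded: for `α + β = 1` the right side would contain `0 ^ 0 = 1` while the integral is
`0`. -/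
theorem lintegral_powDensity_mul_powDensity {α β : ℝ} (hα : 0 < α) (hβ : 0 < β) {s : ℝ}
    (hs : s ≠ 0) :
    ∫⁻ t, powDensity α t * powDensity β (s - t) =
      ENNReal.ofReal (ProbabilityTheory.beta α β) * powDensity (α + β) s := by
  rcases hs.lt_or_gt with hs | hs
  · have h0 : ∀ t, powDensity α t * powDensity β (s - t) = 0 := by
      intro t
      unfold powDensity
      by_cases ht : 0 ≤ t
      · rw [if_neg (show ¬ 0 ≤ s - t by linarith), mul_zero]
      · rw [if_neg ht, zero_mul]
    rw [lintegral_congr h0, lintegral_zero, powDensity, if_neg (not_le.mpr hs), mul_zero]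
  · have hm : Measurable fun t => powDensity α t * powDensity β (s - t) :=
      (measurable_powDensity α).mul ((measurable_powDensity β).comp (by fun_prop))
    rw [lintegral_eq_mul_lintegral_comp_mul_left hs hm]
    have hae : (fun u => powDensity α (s * u) * powDensity β (s - s * u)) =ᵐ[volume]
        fun u => ENNReal.ofReal (s ^ (α + β - 2) * ProbabilityTheory.beta α β) *
          ProbabilityTheory.betaPDF α β u := by
      filter_upwards [Measure.ae_ne volume (0 : ℝ), Measure.ae_ne volume (1 : ℝ)] with u hu0 hu1
      have hb := ProbabilityTheory.beta_pos hα hβ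
      rcases hu0.lt_or_gt with h | h
      · rw [ProbabilityTheory.betaPDF_eq_zero_of_nonpos h.le, mul_zero, powDensity,
          if_neg (by nlinarith), zero_mul]
      rcases hu1.lt_or_gt with h' | h'
      · have hu1' : 0 < 1 - u := by linarith
        rw [ProbabilityTheory.betaPDF_of_pos_lt_one h h', powDensity, powDensity,
          if_pos (by positivity), if_pos (by nlinarith), ← ENNReal.ofReal_mul (by positivity),
          ← ENNReal.ofReal_mul (by positivity)]
        congr 1
        rw [show s - s * u = s * (1 - u) by ring, Real.mul_rpow hs.le h.le,
          Real.mul_rpow hs.le hu1'.le, show α + β - 2 = (α - 1) + (β - 1) by ring,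
          Real.rpow_add hs]
        field_simp
      · rw [ProbabilityTheory.betaPDF_eq_zero_of_one_le h'.le, mul_zero,
          powDensity, powDensity, if_neg (show ¬ 0 ≤ s - s * u by nlinarith), mul_zero]
    rw [lintegral_congr_ae hae, lintegral_const_mul' _ _ ENNReal.ofReal_ne_top,
      ProbabilityTheory.lintegral_betaPDF_eq_one hα hβ, mul_one, powDensity, if_pos hs.le,
      ← ENNReal.ofReal_mul hs.le, ← ENNReal.ofReal_mul (ProbabilityTheory.beta_pos hα hβ).le]
    congr 1
    rw [show α + β - 1 = (α + β - 2) + 1 by ring, Real.rpow_add hs, Real.rpow_one]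
    ring

/-- **Dirichlet's integral**. -/
theorem lintegral_prod_powDensity {n : ℕ} {β : Fin n → ℝ} (hβ : ∀ i, 0 < β i) {γ : ℝ} (hγ : 0 < γ)
    {s : ℝ} (hs : s ≠ 0) :
    ∫⁻ t : Fin n → ℝ, (∏ i, powDensity (β i) (t i)) * powDensity γ (s - ∑ i, t i) =
      ENNReal.ofReal ((∏ i, Real.Gamma (β i)) * Real.Gamma γ / Real.Gamma (∑ i, β i + γ)) *
        powDensity (∑ i, β i + γ) s := by
  induction n generalizing s with
  | zero =>
    have hG := (Real.Gamma_pos_of_pos hγ).ne'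
    rw [lintegral_unique]
    simp [hG, volume_pi]
  | succ n ih =>
    have hmp := (volume_preserving_piFinSuccAbove (fun _ : Fin (n + 1) => ℝ) 0).symm
    have hm : ∀ {m : ℕ} (b : Fin m → ℝ), Measurable fun t : Fin m → ℝ =>
        ∏ i, powDensity (b i) (t i) := fun b =>
      Finset.measurable_prod _ fun i _ => (measurable_powDensity _).comp (measurable_pi_apply i)
    have hmeas : Measurable fun t : Fin (n + 1) → ℝ =>
        (∏ i, powDensity (β i) (t i)) * powDensity γ (s - ∑ i, t i) :=
      (hm β).mul ((measurable_powDensity γ).comp (by fun_prop))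
    have hsum : 0 < ∑ i : Fin n, β i.succ + γ :=
      add_pos_of_nonneg_of_pos (Finset.sum_nonneg fun i _ => (hβ _).le) hγ
    have hmeas' := (hmeas.comp hmp.measurable).aemeasurable
      (μ := (volume : Measure ℝ).prod (volume : Measure (Fin n → ℝ)))
    simp only [Function.comp_def] at hmeas'
    rw [← hmp.lintegral_comp hmeas, Measure.volume_eq_prod, lintegral_prod _ hmeas']
    -- With the first coordinate `u` fixed, the inner integral is the same problem with total `s -
    -- u`; the null case `u = s` is discarded to keep that total nonzero.
    have hinner : ∀ᵐ u : ℝ, ∫⁻ t : Fin n → ℝ,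
        (∏ i, powDensity (β i)
          ((MeasurableEquiv.piFinSuccAbove (fun _ : Fin (n + 1) => ℝ) 0).symm (u, t) i)) *
          powDensity γ (s - ∑ i,
            (MeasurableEquiv.piFinSuccAbove (fun _ : Fin (n + 1) => ℝ) 0).symm (u, t) i) =
        ENNReal.ofReal ((∏ i : Fin n, Real.Gamma (β i.succ)) * Real.Gamma γ /
            Real.Gamma (∑ i : Fin n, β i.succ + γ)) *
          (powDensity (β 0) u * powDensity (∑ i : Fin n, β i.succ + γ) (s - u)) := by
      filter_upwards [Measure.ae_ne volume s] with u hu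
      have e : ∀ t : Fin n → ℝ, (∏ i, powDensity (β i)
          ((MeasurableEquiv.piFinSuccAbove (fun _ : Fin (n + 1) => ℝ) 0).symm (u, t) i)) *
          powDensity γ (s - ∑ i,
            (MeasurableEquiv.piFinSuccAbove (fun _ : Fin (n + 1) => ℝ) 0).symm (u, t) i) =
          powDensity (β 0) u * ((∏ i : Fin n, powDensity (β i.succ) (t i)) *
            powDensity γ ((s - u) - ∑ i, t i)) := by
        intro t
        have e0 : (MeasurableEquiv.piFinSuccAbove (fun _ : Fin (n + 1) => ℝ) 0).symm (u, t) =
            Fin.cons u t := by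
          simp [MeasurableEquiv.piFinSuccAbove_symm_apply, Fin.insertNthEquiv]
        rw [e0, Fin.prod_univ_succ, Fin.sum_univ_succ]
        simp only [Fin.cons_zero, Fin.cons_succ]
        rw [sub_sub, mul_assoc]
      simp_rw [e]
      rw [lintegral_const_mul' _ _ (powDensity_ne_top _ _),
        ih (fun i => hβ i.succ) (sub_ne_zero.mpr hu.symm)]
      ring
    rw [lintegral_congr_ae hinner, lintegral_const_mul' _ _ ENNReal.ofReal_ne_top,
      lintegral_powDensity_mul_powDensity (hβ 0) hsum hs, ← mul_assoc,
      Fin.prod_univ_succ, Fin.sum_univ_succ, ← add_assoc]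
    have hG := Real.Gamma_pos_of_pos hsum
    rw [← ENNReal.ofReal_mul]
    · congr 2
      rw [ProbabilityTheory.beta, ← add_assoc]
      field_simp
    · have : 0 ≤ ∏ i : Fin n, Real.Gamma (β i.succ) :=
        Finset.prod_nonneg fun i _ => (Real.Gamma_pos_of_pos (hβ _)).le
      have := (Real.Gamma_pos_of_pos hγ).le
      positivity

theorem measurable_simplexPoint (k : ℕ) : Measurable (simplexPoint k) := by
  refine measurable_pi_lambda _ fun i => ?_
  unfold simplexPoint
  split_ifs <;> fun_prop

theorem measurableSet_stdSimplex (k : ℕ) : MeasurableSet (stdSimplex ℝ (Fin k)) :=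
  (isClosed_stdSimplex ℝ (Fin k)).measurableSet

/-- Extending each power by zero to negative arguments encodes the indicator of the simplex, so this
is Dirichlet's integral with `s = 1`, the last coordinate carrying `γ`. -/
theorem lintegral_simplexMeasure_prod_rpow {k : ℕ} (hk : 0 < k) {β : Fin k → ℝ}
    (hβ : ∀ i, 0 < β i) :
    ∫⁻ t, ENNReal.ofReal (∏ i, t i ^ (β i - 1)) ∂simplexMeasure k =
      ENNReal.ofReal ((∏ i, Real.Gamma (β i)) / Real.Gamma (∑ i, β i)) := by
  obtain ⟨n, rfl⟩ := Nat.exists_eq_succ_of_ne_zero hk.ne'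
  have hcast : ∀ (t : Fin n → ℝ) (i : Fin n),
      simplexPoint (n + 1) t i.castSucc = t i := by
    intro t i; simp [simplexPoint]
  have hlast : ∀ t : Fin n → ℝ, simplexPoint (n + 1) t (Fin.last n) = 1 - ∑ j, t j := by
    intro t; simp [simplexPoint]
  rw [simplexMeasure, setLIntegral_map (measurableSet_stdSimplex _) (by fun_prop)
    (measurable_simplexPoint _), ← lintegral_indicator
      (measurable_simplexPoint _ (measurableSet_stdSimplex _))]
  have hpt : ∀ t : Fin n → ℝ,
      (simplexPoint (n + 1) ⁻¹' stdSimplex ℝ (Fin (n + 1))).indicator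
        (fun t => ENNReal.ofReal (∏ i, simplexPoint (n + 1) t i ^ (β i - 1))) t =
      (∏ i : Fin n, powDensity (β i.castSucc) (t i)) *
        powDensity (β (Fin.last n)) (1 - ∑ i, t i) := by
    intro t
    by_cases hmem : (∀ i, 0 ≤ t i) ∧ 0 ≤ 1 - ∑ i, t i
    · have h1 : t ∈ simplexPoint (n + 1) ⁻¹' stdSimplex ℝ (Fin (n + 1)) := by
        refine ⟨fun i => ?_, ?_⟩
        · induction i using Fin.lastCases with
          | last => rw [hlast]; exact hmem.2
          | cast i => rw [hcast]; exact hmem.1 i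
        · rw [Fin.sum_univ_castSucc, hlast]
          simp only [hcast]; ring
      rw [Set.indicator_of_mem h1, Fin.prod_univ_castSucc, hlast]
      simp only [hcast, powDensity]
      rw [ENNReal.ofReal_mul (Finset.prod_nonneg fun i _ => Real.rpow_nonneg (hmem.1 i) _),
        if_pos hmem.2, ENNReal.ofReal_prod_of_nonneg fun i _ => Real.rpow_nonneg (hmem.1 i) _]
      congr 1
      exact Finset.prod_congr rfl fun i _ => by rw [if_pos (hmem.1 i)]
    · have h1 : t ∉ simplexPoint (n + 1) ⁻¹' stdSimplex ℝ (Fin (n + 1)) := by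
        intro h
        refine hmem ⟨fun i => ?_, ?_⟩
        · rw [← hcast t]; exact h.1 _
        · rw [← hlast t]; exact h.1 _
      rw [Set.indicator_of_notMem h1]
      symm
      by_cases h2 : 0 ≤ 1 - ∑ i, t i
      · obtain ⟨i, hi⟩ : ∃ i, ¬ 0 ≤ t i := by
          by_contra! h3
          exact hmem ⟨h3, h2⟩
        rw [Finset.prod_eq_zero (Finset.mem_univ i) (by rw [powDensity, if_neg hi]), zero_mul]
      · rw [powDensity.eq_def (β (Fin.last n)), if_neg h2, mul_zero]
  calc _ = ∫⁻ t : Fin n → ℝ, (∏ i : Fin n, powDensity (β i.castSucc) (t i)) *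
        powDensity (β (Fin.last n)) (1 - ∑ i, t i) := lintegral_congr hpt
    _ = _ := by
      rw [lintegral_prod_powDensity (fun i => hβ _) (hβ _) one_ne_zero, Fin.prod_univ_castSucc,
        Fin.sum_univ_castSucc, powDensity, if_pos zero_le_one, Real.one_rpow]
      simp

theorem ae_mem_stdSimplex_dirichletMeasure {k : ℕ} (α : Fin k → ℝ) :
    ∀ᵐ t ∂dirichletMeasure α, t ∈ stdSimplex ℝ (Fin k) :=
  (withDensity_absolutelyContinuous _ _).ae_le (ae_restrict_mem (measurableSet_stdSimplex k))

theorem lintegral_dirichletMeasure_prod_pow {k : ℕ} (hk : 2 ≤ k) (a : Fin k → ℕ) :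
    ∫⁻ t, ENNReal.ofReal (∏ i, t i ^ a i) ∂dirichletMeasure (fun _ : Fin k => 1 / (k : ℝ)) =
      ENNReal.ofReal (dirichletMoment a) := by
  have hk0 : (0 : ℝ) < 1 / k := by positivity
  have hkne : (k : ℝ) ≠ 0 := by positivity
  have hG := Real.Gamma_pos_of_pos hk0
  have hmeas : Measurable fun t : Fin k → ℝ =>
      ENNReal.ofReal (dirichletDensity (fun _ : Fin k => 1 / (k : ℝ)) t) := by
    unfold dirichletDensity; fun_prop
  have hsum1 : ∑ _i : Fin k, 1 / (k : ℝ) = 1 := by simp [hkne]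
  rw [dirichletMeasure, lintegral_withDensity_eq_lintegral_mul _ hmeas (by fun_prop)]
  -- On faces where some `tᵢ = 0`, adding real exponents requires a nonzero sum; `0 < 1 / k ≤ 1 / 2`
  -- guarantees it, which is where `k ≥ 2` enters.
  have hexp : ∀ n : ℕ, 1 / (k : ℝ) - 1 + n ≠ 0 := by
    intro n h
    have hk2 : (2 : ℝ) ≤ k := by exact_mod_cast hk
    have h1 : 1 / (k : ℝ) ≤ 1 / 2 := one_div_le_one_div_of_le two_pos hk2
    rcases n with _ | n
    · simp only [Nat.cast_zero] at h; linarith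
    · push_cast at h
      have : (0 : ℝ) ≤ n := Nat.cast_nonneg n
      linarith
  have hae : ∀ᵐ t ∂simplexMeasure k,
      ((fun t => ENNReal.ofReal (dirichletDensity (fun _ : Fin k => 1 / (k : ℝ)) t)) *
        fun t : Fin k → ℝ => ENNReal.ofReal (∏ i, t i ^ a i)) t =
      ENNReal.ofReal (1 / ∏ _i : Fin k, Real.Gamma (1 / (k : ℝ))) *
        ENNReal.ofReal (∏ i, t i ^ ((1 / k + a i : ℝ) - 1)) := by
    filter_upwards [ae_restrict_mem (measurableSet_stdSimplex k)] with t ht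
    have hP : 0 ≤ 1 / ∏ _i : Fin k, Real.Gamma (1 / (k : ℝ)) := by positivity
    rw [Pi.mul_apply, dirichletDensity, hsum1, Real.Gamma_one, ← ENNReal.ofReal_mul hP,
      ← ENNReal.ofReal_mul (mul_nonneg hP
        (Finset.prod_nonneg fun i _ => Real.rpow_nonneg (ht.1 i) _)), mul_assoc,
      ← Finset.prod_mul_distrib]
    congr 2
    refine Finset.prod_congr rfl fun i _ => ?_
    rw [← Real.rpow_natCast, ← Real.rpow_add' (ht.1 i) (hexp _)]
    congr 1; ring
  rw [lintegral_congr_ae hae, lintegral_const_mul' _ _ ENNReal.ofReal_ne_top,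
    lintegral_simplexMeasure_prod_rpow (by omega) (fun i => by positivity),
    ← ENNReal.ofReal_mul (by positivity), dirichletMoment]
  congr 1
  have hs : ∑ i, (1 / (k : ℝ) + a i) = (∑ i, a i : ℕ) + 1 := by
    rw [Finset.sum_add_distrib, hsum1]; push_cast; ring
  rw [hs, Real.Gamma_nat_eq_factorial, Finset.prod_div_distrib]
  ring

theorem isProbabilityMeasure_dirichletMeasure {k : ℕ} (hk : 2 ≤ k) :
    IsProbabilityMeasure (dirichletMeasure fun _ : Fin k => 1 / (k : ℝ)) := by
  have h := lintegral_dirichletMeasure_prod_pow hk 0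
  have hG : Real.Gamma (1 / k) ≠ 0 := (Real.Gamma_pos_of_pos (by positivity)).ne'
  refine ⟨?_⟩
  have hD : dirichletMoment (0 : Fin k → ℕ) = 1 := by
    simp only [dirichletMoment, Pi.zero_apply, Nat.cast_zero, add_zero]
    rw [div_self hG]; simp
  rw [hD] at h
  simpa using h

theorem integral_dirichletMeasure_prod_pow {k : ℕ} (hk : 2 ≤ k) (a : Fin k → ℕ) :
    ∫ t, ∏ i, t i ^ a i ∂dirichletMeasure (fun _ : Fin k => 1 / (k : ℝ)) =
      dirichletMoment a := by
  have hD : 0 ≤ dirichletMoment a := by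
    refine div_nonneg (Finset.prod_nonneg fun i _ => div_nonneg ?_ ?_) (Nat.cast_nonneg _) <;>
      exact (Real.Gamma_pos_of_pos (by positivity)).le
  rw [integral_eq_lintegral_of_nonneg_ae, lintegral_dirichletMeasure_prod_pow hk,
    ENNReal.toReal_ofReal hD]
  · filter_upwards [ae_mem_stdSimplex_dirichletMeasure _] with t ht
    exact Finset.prod_nonneg fun i _ => pow_nonneg (ht.1 i) _
  · exact (Continuous.measurable (by fun_prop)).aestronglyMeasurable

/-! ### The method of moments -/

open Filter Topology

/-- The method of moments on the cube `[0, 1] ^ k`. -/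
theorem tendsto_integral_of_tendsto_moments {ι : Type*} {l : Filter ι} {k : ℕ}
    {μ : ι → Measure (Fin k → ℝ)} [∀ i, IsProbabilityMeasure (μ i)]
    {ν : Measure (Fin k → ℝ)} [IsProbabilityMeasure ν]
    (hμ : ∀ i, ∀ᵐ t ∂μ i, t ∈ Set.Icc (0 : Fin k → ℝ) 1)
    (hν : ∀ᵐ t ∂ν, t ∈ Set.Icc (0 : Fin k → ℝ) 1)
    (hm : ∀ a : Fin k → ℕ,
      Tendsto (fun i => ∫ t, ∏ j, t j ^ a j ∂μ i) l (𝓝 (∫ t, ∏ j, t j ^ a j ∂ν)))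
    {f : (Fin k → ℝ) → ℝ} (hf : Continuous f) :
    Tendsto (fun i => ∫ t, f t ∂μ i) l (𝓝 (∫ t, f t ∂ν)) := by
  have hintegrable : ∀ {g : (Fin k → ℝ) → ℝ}, Continuous g → ∀ (ρ : Measure (Fin k → ℝ))
      [IsProbabilityMeasure ρ], (∀ᵐ t ∂ρ, t ∈ Set.Icc (0 : Fin k → ℝ) 1) → Integrable g ρ := by
    intro g hg ρ _ hρ
    obtain ⟨B, hB⟩ := isCompact_Icc.exists_bound_of_continuousOn
      (s := Set.Icc (0 : Fin k → ℝ) 1) hg.continuousOn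
    exact Integrable.of_bound hg.aestronglyMeasurable B (hρ.mono fun t ht => hB t ht)
  have hpoly : ∀ P : MvPolynomial (Fin k) ℝ, ∀ (ρ : Measure (Fin k → ℝ))
      [IsProbabilityMeasure ρ], (∀ᵐ t ∂ρ, t ∈ Set.Icc (0 : Fin k → ℝ) 1) →
      ∫ t, MvPolynomial.eval t P ∂ρ =
        ∑ d ∈ P.support, P.coeff d * ∫ t, ∏ j, t j ^ d j ∂ρ := by
    intro P ρ _ hρ
    simp_rw [MvPolynomial.eval_eq']
    rw [integral_finsetSum]
    · simp_rw [integral_const_mul]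
    · intro d _
      exact (hintegrable (by fun_prop) ρ hρ)
  -- Stone–Weierstrass for the algebra generated by the coordinates, which separate the points of
  -- the cube.
  have happrox : ∀ ε > 0, ∃ P : MvPolynomial (Fin k) ℝ,
      ∀ t ∈ Set.Icc (0 : Fin k → ℝ) 1, |MvPolynomial.eval t P - f t| ≤ ε := by
    intro ε hε
    let X := Set.Icc (0 : Fin k → ℝ) 1
    let coord : Fin k → C(X, ℝ) := fun j =>
      ⟨fun t => t.1 j, (continuous_apply j).comp continuous_subtype_val⟩
    let A : Subalgebra ℝ C(X, ℝ) := (MvPolynomial.aeval coord).range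
    have hsep : A.SeparatesPoints := by
      intro s t hst
      obtain ⟨j, hj⟩ := Function.ne_iff.mp fun h => hst (Subtype.ext h)
      exact ⟨coord j, ⟨coord j, ⟨MvPolynomial.X j, by simp⟩, rfl⟩, hj⟩
    obtain ⟨⟨g, P, hP⟩, hg⟩ :=
      ContinuousMap.exists_mem_subalgebra_near_continuousMap_of_separatesPoints A hsep
        (⟨fun t => f t.1, hf.comp continuous_subtype_val⟩ : C(X, ℝ)) ε hε
    refine ⟨P, fun t ht => ?_⟩
    have h1 := (ContinuousMap.norm_coe_le_norm
      (g - (⟨fun t => f t.1, hf.comp continuous_subtype_val⟩ : C(X, ℝ))) ⟨t, ht⟩).trans hg.le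
    have h2 : g ⟨t, ht⟩ = MvPolynomial.eval t P := by
      rw [← hP]
      let ev : C(X, ℝ) →ₐ[ℝ] ℝ := ContinuousMap.evalAlgHom ℝ ℝ (⟨t, ht⟩ : X)
      have h3 : ev (MvPolynomial.aeval coord P) = MvPolynomial.aeval (fun j => ev (coord j)) P := by
        rw [← MvPolynomial.comp_aeval_apply]
      exact h3
    rw [← h2]
    exact h1
  rw [Metric.tendsto_nhds]
  intro ε hε
  obtain ⟨P, hP⟩ := happrox (ε / 4) (by linarith)
  have hPc : Continuous fun t : Fin k → ℝ => MvPolynomial.eval t P :=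
    MvPolynomial.continuous_eval P
  have hclose : ∀ (ρ : Measure (Fin k → ℝ)) [IsProbabilityMeasure ρ],
      (∀ᵐ t ∂ρ, t ∈ Set.Icc (0 : Fin k → ℝ) 1) →
      |∫ t, MvPolynomial.eval t P ∂ρ - ∫ t, f t ∂ρ| ≤ ε / 4 := by
    intro ρ _ hρ
    rw [← integral_sub (hintegrable hPc ρ hρ) (hintegrable hf ρ hρ)]
    have := norm_integral_le_of_norm_le_const (μ := ρ)
      (f := fun t => MvPolynomial.eval t P - f t) (C := ε / 4) (hρ.mono fun t ht => hP t ht)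
    simpa using this
  have hlim : Tendsto (fun i => ∫ t, MvPolynomial.eval t P ∂μ i) l
      (𝓝 (∫ t, MvPolynomial.eval t P ∂ν)) := by
    rw [hpoly P ν hν]
    simp_rw [fun i => hpoly P (μ i) (hμ i)]
    exact tendsto_finsetSum _ fun d _ => (hm d).const_mul _
  filter_upwards [Metric.tendsto_nhds.mp hlim (ε / 4) (by linarith)] with i hi
  rw [Real.dist_eq] at hi ⊢
  have h1 := abs_le.mp (hclose (μ i) (hμ i))
  have h2 := abs_le.mp (hclose ν hν)
  have h3 := abs_lt.mp hi
  rw [abs_lt]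
  constructor <;> linarith [h1.1, h1.2, h2.1, h2.2, h3.1, h3.2]

/-! ### Moments of the random factorization -/

theorem integerAndFactorization_apply {k : ℕ} (hk : 0 < k) {x : ℝ} (hx : 1 ≤ x) (n : ℕ)
    (d : Fin k → ℕ) :
    integerAndFactorization k hk x hx (n, d) =
      if n ∈ Finset.Icc 1 ⌊x⌋₊ ∧ d ∈ Nat.finMulAntidiag k n then
        (⌊x⌋₊ : ENNReal)⁻¹ * ((Nat.finMulAntidiag k n).card : ENNReal)⁻¹ else 0 := by
  rw [integerAndFactorization, PMF.bindOnSupport_apply, tsum_eq_single n]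
  · by_cases hn : n ∈ Finset.Icc 1 ⌊x⌋₊
    · have hne : uniformInteger x hx n ≠ 0 := by
        rw [← PMF.mem_support_iff, uniformInteger, PMF.mem_support_uniformOfFinset_iff]
        exact hn
      have hval : uniformInteger x hx n = (⌊x⌋₊ : ENNReal)⁻¹ := by
        rw [uniformInteger, PMF.uniformOfFinset_apply_of_mem _ hn, Nat.card_Icc,
          Nat.add_sub_cancel]
      rw [dif_neg hne, PMF.map_apply, tsum_eq_single d]
      · rw [hval, if_pos rfl, uniformFactorization, PMF.uniformOfFinset_apply]
        by_cases hd : d ∈ Nat.finMulAntidiag k n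
        · rw [if_pos hd, if_pos ⟨hn, hd⟩]
        · rw [if_neg hd, if_neg (fun h => hd h.2), mul_zero]
      · intro d' hd'
        rw [if_neg]
        rintro h
        exact hd' (Prod.mk.inj h).2.symm
    · have hval : uniformInteger x hx n = 0 := PMF.uniformOfFinset_apply_of_notMem _ hn
      rw [if_neg (fun h => hn h.1), dif_pos hval, mul_zero]
  · intro n' hn'
    split_ifs with h
    · rw [mul_zero]
    · rw [PMF.map_apply, ENNReal.tsum_eq_zero.mpr, mul_zero]
      intro d'
      rw [if_neg]
      rintro h
      exact hn' (Prod.mk.inj h).1.symm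

theorem mem_support_integerAndFactorization {k : ℕ} {hk : 0 < k} {x : ℝ} {hx : 1 ≤ x}
    {q : ℕ × (Fin k → ℕ)} (hq : q ∈ (integerAndFactorization k hk x hx).support) :
    q.1 ∈ Finset.Icc 1 ⌊x⌋₊ ∧ q.2 ∈ Nat.finMulAntidiag k q.1 := by
  obtain ⟨n, d⟩ := q
  rw [PMF.mem_support_iff, integerAndFactorization_apply] at hq
  by_contra h
  exact hq (if_neg h)

theorem ae_mem_support_integerAndFactorization {k : ℕ} (hk : 0 < k) {x : ℝ} (hx : 1 ≤ x) :
    ∀ᵐ q ∂(integerAndFactorization k hk x hx).toMeasure,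
      q ∈ (integerAndFactorization k hk x hx).support := by
  rw [← PMF.restrict_toMeasure_support]
  exact ae_restrict_mem (MeasurableSet.of_discrete)

theorem integral_integerAndFactorization {k : ℕ} (hk : 0 < k) {x : ℝ} (hx : 1 ≤ x)
    (f : ℕ × (Fin k → ℕ) → ℝ) :
    ∫ q, f q ∂(integerAndFactorization k hk x hx).toMeasure =
      (∑ n ∈ Finset.Icc 1 ⌊x⌋₊, factorizationMean k n fun d => f (n, d)) / ⌊x⌋₊ := by
  classical
  -- The law has finite support, so every `f` is integrable and its integral is a finite sum.
  let S : Finset (ℕ × (Fin k → ℕ)) :=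
    (Finset.Icc 1 ⌊x⌋₊ ×ˢ (Finset.Icc 1 ⌊x⌋₊).biUnion (Nat.finMulAntidiag k)).filter
      fun q => q.2 ∈ Nat.finMulAntidiag k q.1
  have hS : ∀ q : ℕ × (Fin k → ℕ), q ∈ S ↔
      q.1 ∈ Finset.Icc 1 ⌊x⌋₊ ∧ q.2 ∈ Nat.finMulAntidiag k q.1 := by
    intro q
    simp only [S, Finset.mem_filter, Finset.mem_product, Finset.mem_biUnion]
    exact ⟨fun h => ⟨h.1.1, h.2⟩, fun h => ⟨⟨h.1, q.1, h.1, h.2⟩, h.2⟩⟩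
  have hsub : (integerAndFactorization k hk x hx).support ⊆ S := fun q hq =>
    (hS q).mpr (mem_support_integerAndFactorization hq)
  have hintegrable : Integrable f (integerAndFactorization k hk x hx).toMeasure := by
    rw [← PMF.restrict_toMeasure_support]
    exact IntegrableOn.finset.mono_set hsub
  rw [PMF.integral_eq_tsum _ _ hintegrable, tsum_eq_sum (s := S), Finset.sum_finset_product S _ _ hS,
    Finset.sum_div]
  · refine Finset.sum_congr rfl fun n hn => ?_
    rw [factorizationMean, Finset.sum_div, Finset.sum_div]
    refine Finset.sum_congr rfl fun d hd => ?_
    rw [integerAndFactorization_apply, if_pos ⟨hn, hd⟩, ENNReal.toReal_mul, ENNReal.toReal_inv,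
      ENNReal.toReal_inv, ENNReal.toReal_natCast, ENNReal.toReal_natCast, smul_eq_mul]
    ring
  · intro q hq
    have : integerAndFactorization k hk x hx q = 0 :=
      (PMF.apply_eq_zero_iff _ _).mpr fun h => hq (hsub h)
    rw [this]; simp

/-- For `n = 1` the convention `x / 0 = 0` gives the zero vector, as the theorem prescribes, and it
lies in the cube. -/
theorem logVector_mem_Icc {k n : ℕ} {d : Fin k → ℕ} (hd : d ∈ Nat.finMulAntidiag k n) :
    logVector (n, d) ∈ Set.Icc (0 : Fin k → ℝ) 1 := by
  have hn : n ≠ 0 := (Nat.mem_finMulAntidiag.mp hd).2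
  refine ⟨fun i => div_nonneg (Real.log_natCast_nonneg _) (Real.log_natCast_nonneg _),
    fun i => div_le_one_of_le₀ ?_ (Real.log_natCast_nonneg _)⟩
  refine Real.log_le_log ?_ ?_
  · exact_mod_cast Nat.pos_of_ne_zero (Nat.ne_zero_of_mem_finMulAntidiag hd i)
  · exact_mod_cast Nat.le_of_dvd (Nat.pos_of_ne_zero hn) (Nat.dvd_of_mem_finMulAntidiag hd i)

theorem HasLogMean.tendsto_div {F : ℕ → ℝ} {D : ℝ} {l : ℕ} (hF : HasLogMean F D l) :
    Tendsto (fun N : ℕ => F N / (N * Real.log N ^ l)) atTop (𝓝 D) := by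
  obtain ⟨C, hC, hb⟩ := hF
  have hlogtop : Tendsto (fun N : ℕ => Real.log N) atTop atTop :=
    Real.tendsto_log_atTop.comp tendsto_natCast_atTop_atTop
  -- Once `log N ≥ 1`, `(1 + log N) ^ (l - 1) ≤ (2 log N) ^ (l - 1)`; in degree `0` the relative
  -- error `1 / N` is below `1 / log N`.
  have hlim : Tendsto (fun N : ℕ => C * (2 ^ l / Real.log N)) atTop (𝓝 0) := by
    have := (hlogtop.const_div_atTop ((2 : ℝ) ^ l)).const_mul C
    simpa using this
  rw [tendsto_iff_norm_sub_tendsto_zero]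
  refine squeeze_zero' (Eventually.of_forall fun _ => norm_nonneg _) ?_ hlim
  filter_upwards [hlogtop.eventually_ge_atTop 1, eventually_ge_atTop 1] with N hL hN
  have hN1 : (1 : ℝ) ≤ N := by exact_mod_cast hN
  have hN0 : (0 : ℝ) < N := by linarith
  have hL0 : 0 < Real.log N := by linarith
  have h := hb N hN1
  rw [Nat.floor_natCast] at h
  have hden : 0 < (N : ℝ) * Real.log N ^ l := by positivity
  have e : F N / (N * Real.log N ^ l) - D =
      (F N - D * N * Real.log N ^ l) / (N * Real.log N ^ l) := by
    field_simp
  rw [Real.norm_eq_abs, e, abs_div, abs_of_pos hden, div_le_iff₀ hden]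
  refine h.trans ?_
  rw [mul_assoc]
  refine mul_le_mul_of_nonneg_left ?_ hC
  unfold meanError
  split_ifs with h0
  · subst h0
    have : Real.log N ≤ N := (Real.log_le_sub_one_of_pos hN0).trans (by linarith)
    rw [pow_zero, pow_zero, mul_one, one_div, inv_mul_eq_div, le_div_iff₀ hL0]
    linarith
  · obtain ⟨m, rfl⟩ := Nat.exists_eq_succ_of_ne_zero h0
    rw [Nat.succ_sub_one, Nat.succ_eq_add_one]
    calc (N : ℝ) * (1 + Real.log N) ^ m ≤ N * (2 * Real.log N) ^ m := by
          gcongr; linarith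
      _ ≤ 2 * (N * (2 * Real.log N) ^ m) := by
          have : 0 ≤ (N : ℝ) * (2 * Real.log N) ^ m := by positivity
          linarith
      _ = _ := by rw [mul_pow, pow_succ, pow_succ]; field_simp

theorem logMoment_nonneg {k : ℕ} (a : Fin k → ℕ) (n : ℕ) : 0 ≤ logMoment a n :=
  factorizationMean_nonneg fun d _ => logMonomial_nonneg a d

theorem logMoment_le {k : ℕ} (a : Fin k → ℕ) (n : ℕ) : logMoment a n ≤ Real.log n ^ ∑ i, a i :=
  factorizationMean_le (pow_nonneg (Real.log_natCast_nonneg _) _) fun _ hd => logMonomial_le a hd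

/-- Normalizing by `log n` or by `log N` makes no difference on average over `n ≤ N`. -/
theorem abs_sum_div_log_pow_sub_le {F : ℕ → ℝ} {m : ℕ} (hF0 : ∀ n, 0 ≤ F n)
    (hF : ∀ n, F n ≤ Real.log n ^ m) {N : ℕ} (hN : 2 ≤ N) :
    |(∑ n ∈ Finset.Icc 1 N, F n / Real.log n ^ m) / N -
      (∑ n ∈ Finset.Icc 1 N, F n) / (N * Real.log N ^ m)| ≤ m / Real.log N := by
  have hN0 : (0 : ℝ) < N := by positivity
  have hL : 0 < Real.log N := Real.log_pos (by exact_mod_cast hN)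
  have e : (∑ n ∈ Finset.Icc 1 N, F n / Real.log n ^ m) / N -
      (∑ n ∈ Finset.Icc 1 N, F n) / (N * Real.log N ^ m) =
      (∑ n ∈ Finset.Icc 1 N, (F n / Real.log n ^ m - F n / Real.log N ^ m)) / N := by
    rw [Finset.sum_sub_distrib, sub_div, ← Finset.sum_div,
      div_div _ _ (N : ℝ), mul_comm (N : ℝ)]
  -- With `q = F n / (log n) ^ m` in `[0, 1]` and `r = log n / log N`, the difference is `q (1 - r ^
  -- m) ≤ m (1 - r)` by Bernoulli. Where `(log n) ^ m = 0`, the bounds on `F` force `F n = 0`.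
  have hterm : ∀ n ∈ Finset.Icc 1 N, |F n / Real.log n ^ m - F n / Real.log N ^ m| ≤
      m * (1 - Real.log n / Real.log N) := by
    intro n hn
    rw [Finset.mem_Icc] at hn
    have hl0 : 0 ≤ Real.log n := Real.log_natCast_nonneg n
    have hle : Real.log n ≤ Real.log N :=
      Real.log_le_log (by exact_mod_cast hn.1) (by exact_mod_cast hn.2)
    have hr1 : Real.log n / Real.log N ≤ 1 := (div_le_one hL).mpr hle
    have hr0 : 0 ≤ Real.log n / Real.log N := div_nonneg hl0 hL.le
    have hq0 : 0 ≤ F n / Real.log n ^ m := div_nonneg (hF0 n) (by positivity)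
    have hq1 : F n / Real.log n ^ m ≤ 1 := div_le_one_of_le₀ (hF n) (by positivity)
    have hFq : F n / Real.log N ^ m =
        F n / Real.log n ^ m * (Real.log n / Real.log N) ^ m := by
      rcases eq_or_ne (Real.log n ^ m) 0 with h | h
      · have hz : F n = 0 := le_antisymm (h ▸ hF n) (hF0 n)
        rw [hz]; simp
      · rw [div_pow]; field_simp
    have hpow1 : (Real.log n / Real.log N) ^ m ≤ 1 := pow_le_one₀ hr0 hr1
    have hbern := one_add_mul_le_pow (a := Real.log n / Real.log N - 1) (by linarith) m
    rw [show 1 + (Real.log n / Real.log N - 1) = Real.log n / Real.log N by ring] at hbern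
    rw [hFq, abs_le]
    constructor <;> nlinarith
  have hfact : ∑ n ∈ Finset.Icc 1 N, Real.log n = Real.log (N.factorial : ℝ) := by
    clear * -
    induction N with
    | zero => simp
    | succ N ih =>
      rw [Finset.sum_Icc_succ_top (by omega), ih, Nat.factorial_succ, Nat.cast_mul,
        Real.log_mul (by positivity) (by positivity), add_comm]
  rw [e, abs_div, abs_of_pos hN0, div_le_iff₀ hN0]
  calc _ ≤ ∑ n ∈ Finset.Icc 1 N, m * (1 - Real.log n / Real.log N) :=
        (Finset.abs_sum_le_sum_abs _ _).trans (Finset.sum_le_sum hterm)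
    _ = m * (N - Real.log (N.factorial : ℝ) / Real.log N) := by
        rw [← Finset.mul_sum, Finset.sum_sub_distrib, ← Finset.sum_div, hfact]
        simp
    -- The lower bound `log N! ≥ N log N - N` makes the average of `1 - log n / log N` at most `1 /
    -- log N`.
    _ ≤ m * (N - (N * Real.log N - N) / Real.log N) := by
        gcongr
        exact natCast_mul_log_sub_le_log_factorial N
    _ = _ := by field_simp; ring

theorem tendsto_sum_logMoment_div {k : ℕ} (hk : 0 < k) (a : Fin k → ℕ) :
    Tendsto (fun N : ℕ => (∑ n ∈ Finset.Icc 1 N, logMoment a n / Real.log n ^ ∑ i, a i) / N)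
      atTop (𝓝 (dirichletMoment a)) := by
  have h1 := (hasLogMean_logMoment hk a).tendsto_div
  have hlogtop : Tendsto (fun N : ℕ => Real.log N) atTop atTop :=
    Real.tendsto_log_atTop.comp tendsto_natCast_atTop_atTop
  have h2 : Tendsto (fun N : ℕ =>
      (∑ n ∈ Finset.Icc 1 N, logMoment a n / Real.log n ^ ∑ i, a i) / N -
        (∑ n ∈ Finset.Icc 1 N, logMoment a n) / (N * Real.log N ^ ∑ i, a i)) atTop (𝓝 0) := by
    rw [tendsto_zero_iff_norm_tendsto_zero]
    refine squeeze_zero' (Eventually.of_forall fun _ => norm_nonneg _) ?_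
      (hlogtop.const_div_atTop ((∑ i, a i : ℕ) : ℝ))
    filter_upwards [eventually_ge_atTop 2] with N hN
    exact abs_sum_div_log_pow_sub_le (logMoment_nonneg a) (logMoment_le a) hN
  simpa using h2.add h1

theorem factorizationMean_prod_logVector_pow {k : ℕ} (a : Fin k → ℕ) (n : ℕ) :
    factorizationMean k n (fun d => ∏ i, logVector (n, d) i ^ a i) =
      logMoment a n / Real.log n ^ ∑ i, a i := by
  rw [logMoment, div_eq_inv_mul, ← factorizationMean_const_mul]
  refine factorizationMean_congr fun d _ => ?_
  simp only [logVector, div_pow, Finset.prod_div_distrib, Finset.prod_pow_eq_pow_sum, logMonomial]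
  rw [div_eq_inv_mul]

end

theorem mainTheorem2 (k : ℕ) (hk : 2 ≤ k) :
    ∃ _ : IsProbabilityMeasure (dirichletMeasure fun _ : Fin k => 1 / (k : ℝ)),
      TendstoInDistribution
        (fun _ : Set.Ici (1 : ℝ) => (logVector : ℕ × (Fin k → ℕ) → (Fin k → ℝ)))
        Filter.atTop
        (id : (Fin k → ℝ) → (Fin k → ℝ))
        (fun x : Set.Ici (1 : ℝ) =>
          (integerAndFactorization k (by omega) (x : ℝ) x.2).toMeasure)
        (dirichletMeasure fun _ : Fin k => 1 / (k : ℝ)) := by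
  have hk0 : 0 < k := by omega
  have hprob := isProbabilityMeasure_dirichletMeasure hk
  have hmeas : Measurable (logVector : ℕ × (Fin k → ℕ) → (Fin k → ℝ)) := Measurable.of_discrete
  refine ⟨hprob, ⟨fun _ => hmeas.aemeasurable, aemeasurable_id, ?_⟩⟩
  refine ProbabilityMeasure.tendsto_iff_forall_integral_tendsto.mpr fun f => ?_
  simp only [ProbabilityMeasure.coe_mk, Measure.map_id]
  -- The moments depend on `x` only through `⌊x⌋₊`, so limits along the integers suffice.
  have hfloor : Filter.Tendsto (fun x : Set.Ici (1 : ℝ) => ⌊(x : ℝ)⌋₊) Filter.atTop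
      Filter.atTop :=
    tendsto_nat_floor_atTop.comp (Filter.tendsto_comp_val_Ici_atTop.mpr Filter.tendsto_id)
  have : ∀ x : Set.Ici (1 : ℝ), IsProbabilityMeasure
      ((integerAndFactorization k hk0 (x : ℝ) x.2).toMeasure.map logVector) := fun x =>
    Measure.isProbabilityMeasure_map hmeas.aemeasurable
  refine tendsto_integral_of_tendsto_moments (fun x => ?_) ?_ (fun a => ?_) f.continuous
  · refine (ae_map_iff hmeas.aemeasurable measurableSet_Icc).mpr ?_
    filter_upwards [ae_mem_support_integerAndFactorization hk0 x.2] with q hq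
    exact logVector_mem_Icc (mem_support_integerAndFactorization hq).2
  · filter_upwards [ae_mem_stdSimplex_dirichletMeasure _] with t ht
    exact ⟨fun i => ht.1 i, fun i =>
      (Finset.single_le_sum (fun j _ => ht.1 j) (Finset.mem_univ i)).trans_eq ht.2⟩
  · rw [integral_dirichletMeasure_prod_pow hk]
    have hmom : ∀ x : Set.Ici (1 : ℝ), ∫ t, ∏ j, t j ^ a j
        ∂((integerAndFactorization k hk0 (x : ℝ) x.2).toMeasure.map logVector) =
        (∑ n ∈ Finset.Icc 1 ⌊(x : ℝ)⌋₊, logMoment a n / Real.log n ^ ∑ i, a i) /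
          ⌊(x : ℝ)⌋₊ := by
      intro x
      rw [integral_map hmeas.aemeasurable
        (Continuous.measurable (by fun_prop)).aestronglyMeasurable,
        integral_integerAndFactorization hk0 x.2]
      simp_rw [factorizationMean_prod_logVector_pow]
    simp_rw [hmom]
    exact (tendsto_sum_logMoment_div hk0 a).comp hfloor
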